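/- Let $\mathcal H$ be a finite-dimensional complex Hilbert space with a fixed orthonormal reference basis. States are density matrices (positive semidefinite, trace $1$) and $\mathcal I$ is the set of incoherent states, i.e. density matrices that are diagonal in the reference basis. For $q\in(0,1)$, an invertible state $\rho$ and any state $\sigma$ put $$f_q(\rho,\sigma)=\mathrm{Tr}\big[\rho^{1/2}\big(\rho^{-1/2}\sigma\rho^{-1/2}\big)^{1-q}\rho^{1/2}\big],$$ and for a singular state $\rho$ let $f_q(\rho,\sigma)=\lim_{\varepsilon\downarrow0}f_q(\rho+\varepsilon I,\sigma)$, where $f_q(\rho+\varepsilon I,\sigma)$ is given by the same formula. Put $$D_q(\rho\|\sigma)=\frac{f_q(\rho,\sigma)^{1/q}-1}{q-1},\qquad C_q(\rho)=\min_{\sigma\in\mathcal I}D_q(\rho\|\sigma).$$ An incoherent operation is a map $\Phi(X)=\sum_nK_nXK_n^\dagger$ on the matrices over $\mathcal H$, given by finitely many operators $K_n$ on $\mathcal H$ with $\sum_nK_n^\dagger K_n=I$ such that $K_n\sigma K_n^\dagger/\mathrm{Tr}(K_n\sigma K_n^\dagger)\in\mathcal I$ for all $n$ and all $\sigma\in\mathcal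 I$ with $\mathrm{Tr}(K_n\sigma K_n^\dagger)\neq0$; such $K_n$ are called incoherent Kraus operators. **Theorem.** Let $q\in(0,1)$. For all states $\rho,\sigma$ the limit $\lim_{\varepsilon\downarrow0}f_q(\rho+\varepsilon I,\sigma)$ exists, it equals $f_q(\rho,\sigma)$ as given by the formula when $\rho$ is invertible, and the minimum defining $C_q(\rho)$ is attained. Moreover $C_q$ is a coherence measure: 1. (Faithfulness) $C_q(\rho)\ge0$ for every state $\rho$, and $C_q(\rho)=0$ if and only if $\rho\in\mathcal I$. 2. (Monotonicity) $C_q(\Phi(\rho))\le C_q(\rho)$ for every state $\rho$ and every incoherent operation $\Phi$. 3. (Strong monotonicity) For every state $\rho$ and all incoherent Kraus operators $(K_n)$, with $p_n=\mathrm{Tr}(K_n\rho K_n^\dagger)$ and $\rho_n=K_n\rho K_n^\dagger/p_n$, $\sum_{n:\,p_n>0}p_nC_q(\rho_n)\le C_q(\rho)$. 4. (Convexity) $C_q\big(\sum_np_n\rho_n\big)\le\sum_np_nC_q(\rho_n)$ for all finite families of states $\rho_n$ and $p_n\ge0$ with $\sum_np_n=1$. 5. (Additivity on block-diagonal states) $C_q\big(p\rho_1\oplus(1-p)\rho_2\big)=pC_q(\rho_1)+(1-p)C_q(\rho_2)$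 for all $p\in[0,1]$ and all states $\rho_1,\rho_2$ on finite-dimensional spaces $\mathcal H_1,\mathcal H_2$ with reference bases, where $\mathcal H_1\oplus\mathcal H_2$ carries the union of the two bases. -/

import Mathlib

open scoped MatrixOrder ComplexOrder

universe u

/-! Coherence quantifiers built from the Tsallis relative operator entropy. A finite dimensional
Hilbert space with a fixed orthonormal basis indexed by `ι` is represented by matrices
`Matrix ι ι ℂ`; real powers of positive semidefinite matrices are those of the continuous
functional calculus. -/

namespace TsallisCoherence

/-- Density matrices: positive semidefinite of trace one. -/
structure IsState {ι : Type*} [Fintype ι] (ρ : Matrix ι ι ℂ) : Prop where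
  posSemidef : ρ.PosSemidef
  trace_eq_one : ρ.trace = 1

/-- Incoherent states: density matrices that are diagonal in the reference basis. -/
structure IsIncoherent {ι : Type*} [Fintype ι] (σ : Matrix ι ι ℂ) : Prop where
  isState : IsState σ
  isDiag : σ.IsDiag

/-- The expression `Tr [A ^ (1/2) (A ^ (-1/2) B A ^ (-1/2)) ^ (1-q) A ^ (1/2)]`. It is used only
for positive definite `A` and positive semidefinite `B`, for which it is a nonnegative real. -/
noncomputable def fInv {ι : Type*} [Fintype ι] [DecidableEq ι] (q : ℝ) (A B : Matrix ι ι ℂ) : ℝ :=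
  (Matrix.trace (A ^ (1 / 2 : ℝ) * (A ^ (-(1 / 2) : ℝ) * B * A ^ (-(1 / 2) : ℝ)) ^ (1 - q)
    * A ^ (1 / 2 : ℝ))).re

/-- `f_q(ρ, σ)` for arbitrary states: the expression above at `ρ + ε 1`, in the limit `ε ↓ 0`.
That the limit exists, and that nothing changes when `ρ` is invertible, is part of the
main statement. -/
noncomputable def f {ι : Type*} [Fintype ι] [DecidableEq ι] (q : ℝ) (ρ σ : Matrix ι ι ℂ) : ℝ :=
  Filter.limUnder (nhdsWithin (0 : ℝ) (Set.Ioi 0))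
    (fun ε : ℝ => fInv q (ρ + (ε : ℂ) • (1 : Matrix ι ι ℂ)) σ)

/-- `D_q(ρ‖σ) = (f_q(ρ, σ) ^ (1/q) - 1) / (q - 1)`. -/
noncomputable def D {ι : Type*} [Fintype ι] [DecidableEq ι] (q : ℝ) (ρ σ : Matrix ι ι ℂ) : ℝ :=
  1 / (q - 1) * ((f q ρ σ) ^ (1 / q) - 1)

/-- `C_q(ρ)`, the infimum of `D_q(ρ‖σ)` over all incoherent `σ`. That it is a minimum is part of
the main statement. -/
noncomputable def C {ι : Type*} [Fintype ι] [DecidableEq ι] (q : ℝ) (ρ : Matrix ι ι ℂ) : ℝ :=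
  sInf ((fun σ => D q ρ σ) '' {σ : Matrix ι ι ℂ | IsIncoherent σ})

/-- A finite family of incoherent Kraus operators: `∑ Kₙ† Kₙ = 1`, and every outcome that occurs
with nonzero probability on an incoherent state leaves an incoherent state. -/
structure IsIncoherentKraus {ι : Type*} [Fintype ι] [DecidableEq ι] {N : ℕ}
    (K : Fin N → Matrix ι ι ℂ) : Prop where
  complete : ∑ n, (K n).conjTranspose * K n = 1
  incoherent : ∀ (n : Fin N) (σ : Matrix ι ι ℂ), IsIncoherent σ →
    (K n * σ * (K n).conjTranspose).trace ≠ 0 →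
      IsIncoherent ((K n * σ * (K n).conjTranspose).trace⁻¹ • (K n * σ * (K n).conjTranspose))

/-- Incoherent operations: completely positive trace preserving maps that admit an incoherent
Kraus representation. -/
def IsIncoherentOperation {ι : Type*} [Fintype ι] [DecidableEq ι]
    (Φ : Matrix ι ι ℂ →ₗ[ℂ] Matrix ι ι ℂ) : Prop :=
  ∃ (N : ℕ) (K : Fin N → Matrix ι ι ℂ), IsIncoherentKraus K ∧
    ∀ X, Φ X = ∑ n, K n * X * (K n).conjTranspose

/-- The probability `pₙ = Tr Kₙ ρ Kₙ†` of an outcome. -/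
noncomputable def prob {ι : Type*} [Fintype ι] (K ρ : Matrix ι ι ℂ) : ℝ :=
  (K * ρ * K.conjTranspose).trace.re

/-- The post-measurement state `Kₙ ρ Kₙ† / pₙ`. -/
noncomputable def post {ι : Type*} [Fintype ι] (K ρ : Matrix ι ι ℂ) : Matrix ι ι ℂ :=
  ((prob K ρ)⁻¹ : ℂ) • (K * ρ * K.conjTranspose)

/-- A coherence measure: a function of the states of all finite dimensional spaces with a
reference basis that satisfies the standard axioms. -/
structure IsCoherenceMeasure
    (M : ∀ (ι : Type u) [Fintype ι] [DecidableEq ι], Matrix ι ι ℂ → ℝ) : Prop where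
  /-- faithfulness, first half -/
  nonneg : ∀ (ι : Type u) [Fintype ι] [DecidableEq ι] (ρ : Matrix ι ι ℂ),
    IsState ρ → 0 ≤ M ι ρ
  /-- faithfulness, second half -/
  eq_zero_iff : ∀ (ι : Type u) [Fintype ι] [DecidableEq ι] (ρ : Matrix ι ι ℂ),
    IsState ρ → (M ι ρ = 0 ↔ IsIncoherent ρ)
  /-- monotonicity under incoherent operations -/
  monotone : ∀ (ι : Type u) [Fintype ι] [DecidableEq ι]
    (Φ : Matrix ι ι ℂ →ₗ[ℂ] Matrix ι ι ℂ) (ρ : Matrix ι ι ℂ),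
    IsIncoherentOperation Φ → IsState ρ → M ι (Φ ρ) ≤ M ι ρ
  /-- strong monotonicity under selective incoherent operations; an outcome of probability zero
  contributes zero to the sum -/
  strong_monotone : ∀ (ι : Type u) [Fintype ι] [DecidableEq ι] (N : ℕ)
    (K : Fin N → Matrix ι ι ℂ) (ρ : Matrix ι ι ℂ),
    IsIncoherentKraus K → IsState ρ →
      ∑ n, prob (K n) ρ * M ι (post (K n) ρ) ≤ M ι ρ
  /-- convexity -/
  convex : ∀ (ι : Type u) [Fintype ι] [DecidableEq ι] (N : ℕ)
    (p : Fin N → ℝ) (ρ : Fin N → Matrix ι ι ℂ),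
    (∀ n, 0 ≤ p n) → ∑ n, p n = 1 → (∀ n, IsState (ρ n)) →
      M ι (∑ n, (p n : ℂ) • ρ n) ≤ ∑ n, p n * M ι (ρ n)
  /-- additivity on block-diagonal states -/
  additive : ∀ (ι κ : Type u) [Fintype ι] [DecidableEq ι] [Fintype κ] [DecidableEq κ]
    (p : ℝ) (ρ₁ : Matrix ι ι ℂ) (ρ₂ : Matrix κ κ ℂ),
    0 ≤ p → p ≤ 1 → IsState ρ₁ → IsState ρ₂ →
      M (ι ⊕ κ) (Matrix.fromBlocks ((p : ℂ) • ρ₁) 0 0 (((1 - p : ℝ) : ℂ) • ρ₂))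
        = p * M ι ρ₁ + (1 - p) * M κ ρ₂

end TsallisCoherence

/-! The whole proof rests on a variational formula for the weighted geometric mean `gm q A B`, whose
trace is `fInv q A B`. For 0 < p < 1 the power x ^ p is an integral of t ^ (p-1) * x / (t + x)
against a fixed measure in t, and each integrand, read as a quadratic form, is a minimum. With p = 1
- q this gives ⟨v, gm v⟩ = ∫ min_y t ^ (p-1) (t⁻¹⟨y, B y⟩ + ⟨v - y, A (v - y)⟩). The functional
under the minimum is linear and increasing in (A, B), and conjugating A and B by K amounts to
applying Kᴴ to the vectors. So `gm` is monotone, jointly superadditive and satisfies K gm(A, B) Kᴴ ≤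
gm(K A Kᴴ, K B Kᴴ) for invertible first arguments (`qf_gm_conj_le`, `qf_gm_add_le`). Taking traces
and letting ε ↓ 0, `f` grows under measurements (`f_le_sum_conj`), is superadditive (`f_add_le`) and
has degree q in the first and 1 - q in the second argument (`f_smul_smul`).

The axioms are then proved for G(ρ) = max_σ f(ρ, σ) ^ (1/q) = 1 - (1 - q) C(ρ), called `overlap`.
Strong monotonicity is data processing followed by Hölder with exponents 1/q and 1/(1-q). Convexity
is superadditivity, with the weights of the optimal σ_n chosen for equality in Hölder. Together they
give monotonicity. On block-diagonal states, one inequality is convexity plus isometric embedding of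
the blocks, the other is the Hölder argument for the measurement of the block. Faithfulness follows
by measuring in an eigenbasis of ρ - σ and using weighted AM-GM. -/

namespace TsallisCoherence

open Matrix MeasureTheory Set Filter Topology

/-! ### Quadratic forms and the functional calculus. -/

section QuadraticForm

variable {ι κ : Type*} [Fintype ι] [Fintype κ]

/-- The real part of the quadratic form `v ↦ ⟨v, M v⟩`. -/
noncomputable def qf (M : Matrix ι ι ℂ) (v : ι → ℂ) : ℝ := (star v ⬝ᵥ M *ᵥ v).re

lemma qf_add (M N : Matrix ι ι ℂ) (v : ι → ℂ) : qf (M + N) v = qf M v + qf N v := by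
  simp [qf, add_mulVec, dotProduct_add]

lemma qf_sub (M N : Matrix ι ι ℂ) (v : ι → ℂ) : qf (M - N) v = qf M v - qf N v := by
  simp [qf, sub_mulVec, dotProduct_sub]

lemma qf_mul_mul_conjTranspose (K : Matrix κ ι ℂ) (M : Matrix ι ι ℂ) (v : κ → ℂ) :
    qf (K * M * Kᴴ) v = qf M (Kᴴ *ᵥ v) := by
  simp only [qf, star_mulVec, conjTranspose_conjTranspose, ← mulVec_mulVec, dotProduct_mulVec]

lemma qf_nonneg {M : Matrix ι ι ℂ} (hM : M.PosSemidef) (v : ι → ℂ) : 0 ≤ qf M v :=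
  (Complex.le_def.1 (hM.dotProduct_mulVec_nonneg v)).1

lemma qf_mono {M N : Matrix ι ι ℂ} (h : M ≤ N) (v : ι → ℂ) : qf M v ≤ qf N v := by
  have := qf_nonneg (le_iff.1 h) v
  rw [qf_sub] at this
  linarith

variable [DecidableEq ι] [DecidableEq κ]

lemma qf_single (M : Matrix ι ι ℂ) (i : ι) : qf M (Pi.single i 1) = (M i i).re := by
  simp [qf]

lemma re_trace_eq_sum_qf (M : Matrix ι ι ℂ) :
    M.trace.re = ∑ i, qf M (Pi.single i 1) := by
  simp [qf_single, trace]

lemma qf_diagonal (d : ι → ℝ) (v : ι → ℂ) :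
    qf (diagonal fun i => (d i : ℂ)) v = ∑ i, d i * ‖v i‖ ^ 2 := by
  simp only [qf, dotProduct, mulVec_diagonal, Complex.re_sum]
  refine Finset.sum_congr rfl fun i _ => ?_
  have : star v i * (↑(d i) * v i) = ((d i * ‖v i‖ ^ 2 : ℝ) : ℂ) := by
    have := Complex.conj_mul' (v i)
    simp only [Pi.star_apply, RCLike.star_def]
    push_cast
    rw [← this]; ring
  rw [this, Complex.ofReal_re]

lemma qf_cfc {X : Matrix ι ι ℂ} (hX : X.IsHermitian) (g : ℝ → ℝ) (w : ι → ℂ) :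
    qf (cfc g X) w =
      ∑ i, g (hX.eigenvalues i) * ‖((hX.eigenvectorUnitary : Matrix ι ι ℂ)ᴴ *ᵥ w) i‖ ^ 2 := by
  rw [hX.cfc_eq, IsHermitian.cfc, Unitary.conjStarAlgAut_apply, star_eq_conjTranspose,
    qf_mul_mul_conjTranspose, ← qf_diagonal]
  rfl

lemma qf_eq_sum_eigenvalues {X : Matrix ι ι ℂ} (hX : X.IsHermitian) (w : ι → ℂ) :
    qf X w = ∑ i, hX.eigenvalues i * ‖((hX.eigenvectorUnitary : Matrix ι ι ℂ)ᴴ *ᵥ w) i‖ ^ 2 := by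
  rw [← qf_cfc hX (fun x => x), cfc_id' ℝ X hX.isSelfAdjoint]

lemma qf_one_eq_sum {X : Matrix ι ι ℂ} (hX : X.IsHermitian) (w : ι → ℂ) :
    qf 1 w = ∑ i, ‖((hX.eigenvectorUnitary : Matrix ι ι ℂ)ᴴ *ᵥ w) i‖ ^ 2 := by
  rw [← cfc_const_one ℝ X hX.isSelfAdjoint, qf_cfc hX]
  simp

end QuadraticForm

/-- The real measure that represents `x ↦ x ^ p` by the integrals of `Real.rpowIntegrand₀₁ p`. -/
def IsRpowMeasure (p : ℝ) (μ : Measure ℝ) : Prop :=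
  ∀ x ∈ Ici (0 : ℝ), IntegrableOn (fun t => Real.rpowIntegrand₀₁ p t x) (Ioi 0) μ
      ∧ x ^ p = ∫ t in Ioi 0, Real.rpowIntegrand₀₁ p t x ∂μ

/-! ### Variational formula for the weighted geometric mean. -/

section Variational

variable {ι κ : Type*} [Fintype ι] [Fintype κ] [DecidableEq ι] [DecidableEq κ]

/-- After the triangle inequality, the two sides differ by a multiple of the square (x‖z‖ - t‖c -
z‖)². -/
lemma rpowIntegrand_mul_norm_sq_le {p t x : ℝ} (hp : p ∈ Ioo 0 1) (ht : 0 < t) (hx : 0 ≤ x)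
    (c z : ℂ) :
    Real.rpowIntegrand₀₁ p t x * ‖c‖ ^ 2 ≤
      t ^ (p - 1) * (t⁻¹ * (x * ‖z‖ ^ 2) + ‖c - z‖ ^ 2) := by
  rw [Real.rpowIntegrand₀₁_eq_pow_div hp ht.le hx, mul_div_assoc, mul_assoc]
  gcongr
  have h : ‖c‖ ^ 2 ≤ (‖z‖ + ‖c - z‖) ^ 2 := by
    gcongr
    simpa using norm_add_le z (c - z)
  have htx : 0 < t + x := by linarith
  set a := ‖z‖
  set b := ‖c - z‖
  have key : x / (t + x) * (a + b) ^ 2 ≤ t⁻¹ * (x * a ^ 2) + b ^ 2 := by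
    have : t⁻¹ * (x * a ^ 2) + b ^ 2 - x / (t + x) * (a + b) ^ 2 =
        (x * a - t * b) ^ 2 / (t * (t + x)) := by
      field_simp
      ring
    have h2 : 0 ≤ (x * a - t * b) ^ 2 / (t * (t + x)) := by positivity
    linarith
  exact le_trans (by gcongr) key

/-- The minimiser z = t / (t + x) * c makes that square vanish and the triangle inequality tight. -/
lemma rpowIntegrand_mul_norm_sq_eq {p t x : ℝ} (hp : p ∈ Ioo 0 1) (ht : 0 < t) (hx : 0 ≤ x)
    (c : ℂ) :
    t ^ (p - 1) * (t⁻¹ * (x * ‖((t / (t + x) : ℝ) : ℂ) * c‖ ^ 2) +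
      ‖c - ((t / (t + x) : ℝ) : ℂ) * c‖ ^ 2) = Real.rpowIntegrand₀₁ p t x * ‖c‖ ^ 2 := by
  have htx : 0 < t + x := by linarith
  have h1 : c - ((t / (t + x) : ℝ) : ℂ) * c = ((x / (t + x) : ℝ) : ℂ) * c := by
    have : ((x / (t + x) : ℝ) : ℂ) = 1 - ((t / (t + x) : ℝ) : ℂ) := by
      rw [← Complex.ofReal_one, ← Complex.ofReal_sub]
      congr 1
      field_simp
      ring
    rw [this]; ring
  rw [h1, Real.rpowIntegrand₀₁_eq_pow_div hp ht.le hx, norm_mul, norm_mul, Complex.norm_real,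
    Complex.norm_real, mul_pow, mul_pow, Real.norm_eq_abs, Real.norm_eq_abs, sq_abs, sq_abs]
  field_simp

/-- The quadratic form of `X ^ p` is an integral of minima of quadratic forms. -/
theorem exists_integral_eq_qf_rpow {p : ℝ} (hp : p ∈ Ioo 0 1) {μ : Measure ℝ}
    (hμ : IsRpowMeasure p μ) {X : Matrix ι ι ℂ} (hX : X.PosSemidef) (w : ι → ℂ) :
    ∃ m : ℝ → ℝ, IntegrableOn m (Ioi 0) μ ∧ qf (X ^ p) w = ∫ t in Ioi 0, m t ∂μ ∧
      ∀ t > 0, IsLeast (range fun z => t ^ (p - 1) * (t⁻¹ * qf X z + qf 1 (w - z))) (m t) := by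
  set U := (hX.1.eigenvectorUnitary : Matrix ι ι ℂ) with hU
  have hUU : Uᴴ * U = 1 := Unitary.coe_star_mul_self hX.1.eigenvectorUnitary
  set c := Uᴴ *ᵥ w with hc
  have hev := hX.eigenvalues_nonneg
  refine ⟨fun t => ∑ i, Real.rpowIntegrand₀₁ p t (hX.1.eigenvalues i) * ‖c i‖ ^ 2, ?_, ?_, ?_⟩
  · exact integrable_finsetSum _ fun i _ => ((hμ _ (hev i)).1.mul_const _)
  · rw [integral_finsetSum _ fun i _ => ((hμ _ (hev i)).1.mul_const _),
      CFC.rpow_eq_cfc_real hX.nonneg, qf_cfc hX.1]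
    refine Finset.sum_congr rfl fun i _ => ?_
    rw [integral_mul_const, ← (hμ _ (hev i)).2]
  · intro t ht
    -- In an eigenbasis of X the functional splits into one scalar problem per coordinate.
    have expand (z : ι → ℂ) : t ^ (p - 1) * (t⁻¹ * qf X z + qf 1 (w - z)) =
        ∑ i, t ^ (p - 1) * (t⁻¹ * (hX.1.eigenvalues i * ‖(Uᴴ *ᵥ z) i‖ ^ 2) +
          ‖c i - (Uᴴ *ᵥ z) i‖ ^ 2) := by
      rw [qf_eq_sum_eigenvalues hX.1, qf_one_eq_sum hX.1, ← hU, mulVec_sub, ← hc,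
        Finset.mul_sum, ← Finset.sum_add_distrib, Finset.mul_sum]
      rfl
    constructor
    · refine ⟨U *ᵥ fun i => ((t / (t + hX.1.eigenvalues i) : ℝ) : ℂ) * c i, ?_⟩
      dsimp only
      rw [expand]
      refine Finset.sum_congr rfl fun i _ => ?_
      rw [mulVec_mulVec, hUU, one_mulVec, rpowIntegrand_mul_norm_sq_eq hp ht (hev i)]
    · rintro _ ⟨z, rfl⟩
      dsimp only
      rw [expand]
      exact Finset.sum_le_sum fun i _ => rpowIntegrand_mul_norm_sq_le hp ht (hev i) _ _

/-- The weighted geometric mean `A ^ (1/2) (A ^ (-1/2) B A ^ (-1/2)) ^ (1-q) A ^ (1/2)`. -/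
noncomputable def gm (q : ℝ) (A B : Matrix ι ι ℂ) : Matrix ι ι ℂ :=
  A ^ (1 / 2 : ℝ) * (A ^ (-(1 / 2) : ℝ) * B * A ^ (-(1 / 2) : ℝ)) ^ (1 - q) * A ^ (1 / 2 : ℝ)

omit [DecidableEq κ] in
lemma isHermitian_rpow (A : Matrix ι ι ℂ) (r : ℝ) : (A ^ r)ᴴ = A ^ r :=
  (CFC.rpow_nonneg (a := A) (y := r)).posSemidef.1

lemma posSemidef_sandwich (A : Matrix ι ι ℂ) {B : Matrix ι ι ℂ} (hB : B.PosSemidef) (r : ℝ) :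
    (A ^ r * B * A ^ r).PosSemidef := by
  simpa [isHermitian_rpow] using hB.mul_mul_conjTranspose_same (A ^ r)

lemma rpow_half_mul_self {A : Matrix ι ι ℂ} (hA : A.PosDef) :
    A ^ (1 / 2 : ℝ) * A ^ (1 / 2 : ℝ) = A := by
  rw [← CFC.rpow_add hA.isUnit, add_halves, CFC.rpow_one A hA.posSemidef.nonneg]

lemma posSemidef_gm (q : ℝ) (A B : Matrix ι ι ℂ) : (gm q A B).PosSemidef :=
  posSemidef_sandwich A CFC.rpow_nonneg.posSemidef _

/-- The substitution z = A ^ (1/2) y, a bijection because A is invertible, removes the powers of A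
and leaves a functional linear in A and B. -/
theorem exists_integral_eq_qf_gm {q : ℝ} (hq : q ∈ Ioo 0 1) {μ : Measure ℝ}
    (hμ : IsRpowMeasure (1 - q) μ) {A B : Matrix ι ι ℂ} (hA : A.PosDef) (hB : B.PosSemidef)
    (v : ι → ℂ) :
    ∃ m : ℝ → ℝ, IntegrableOn m (Ioi 0) μ ∧ qf (gm q A B) v = ∫ t in Ioi 0, m t ∂μ ∧
      ∀ t > 0, IsLeast (range fun y => t ^ (1 - q - 1) * (t⁻¹ * qf B y + qf A (v - y)))
        (m t) := by
  obtain ⟨m, hm, h1, h2⟩ := exists_integral_eq_qf_rpow (p := 1 - q)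
    ⟨by linarith [hq.2], by linarith [hq.1]⟩ hμ
    (posSemidef_sandwich A hB (-(1 / 2))) (A ^ (1 / 2 : ℝ) *ᵥ v)
  refine ⟨m, hm, ?_, fun t ht => ?_⟩
  · rw [← h1, gm]
    have := qf_mul_mul_conjTranspose (A ^ (1 / 2 : ℝ))
      ((A ^ (-(1 / 2) : ℝ) * B * A ^ (-(1 / 2) : ℝ)) ^ (1 - q)) v
    rwa [isHermitian_rpow] at this
  · have hr : A ^ (1 / 2 : ℝ) * A ^ (-(1 / 2) : ℝ) = 1 :=
      CFC.rpow_mul_rpow_neg _ hA.isStrictlyPositive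
    have hl : A ^ (-(1 / 2) : ℝ) * A ^ (1 / 2 : ℝ) = 1 :=
      CFC.rpow_neg_mul_rpow _ hA.isStrictlyPositive
    have hval (y : ι → ℂ) : qf (A ^ (-(1 / 2) : ℝ) * B * A ^ (-(1 / 2) : ℝ))
        (A ^ (1 / 2 : ℝ) *ᵥ y) = qf B y := by
      have := qf_mul_mul_conjTranspose (A ^ (-(1 / 2) : ℝ)) B (A ^ (1 / 2 : ℝ) *ᵥ y)
      rwa [isHermitian_rpow, mulVec_mulVec, hl, one_mulVec] at this
    have hval1 (y : ι → ℂ) : qf 1 (A ^ (1 / 2 : ℝ) *ᵥ y) = qf A y := by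
      have := qf_mul_mul_conjTranspose (A ^ (1 / 2 : ℝ)) 1 y
      rw [isHermitian_rpow, mul_one, rpow_half_mul_self hA] at this
      exact this.symm
    convert! h2 t ht using 1
    ext s
    constructor
    · rintro ⟨y, rfl⟩
      refine ⟨A ^ (1 / 2 : ℝ) *ᵥ y, ?_⟩
      simp only [← mulVec_sub, hval, hval1]
    · rintro ⟨z, rfl⟩
      refine ⟨A ^ (-(1 / 2) : ℝ) *ᵥ z, ?_⟩
      have hz : z = A ^ (1 / 2 : ℝ) *ᵥ (A ^ (-(1 / 2) : ℝ) *ᵥ z) := by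
        rw [mulVec_mulVec, hr, one_mulVec]
      conv_rhs => rw [hz]
      simp only [← mulVec_sub, hval, hval1]

/-- If y is optimal for (A', B', v), then Kᴴ y is a competitor for (A, B, Kᴴ v) of no larger value.
The slack in A' lets it stay invertible when K A Kᴴ is not. -/
theorem qf_gm_conj_le {q : ℝ} (hq : q ∈ Ioo 0 1) {A B : Matrix ι ι ℂ} {A' B' : Matrix κ κ ℂ}
    (hA : A.PosDef) (hB : B.PosSemidef) (hA' : A'.PosDef) (hB' : B'.PosSemidef)
    (K : Matrix κ ι ℂ) (hKA : K * A * Kᴴ ≤ A') (hKB : K * B * Kᴴ ≤ B') (v : κ → ℂ) :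
    qf (gm q A B) (Kᴴ *ᵥ v) ≤ qf (gm q A' B') v := by
  obtain ⟨μ, hμ⟩ := Real.exists_measure_rpow_eq_integral_rpowIntegrand₀₁ (p := 1 - q)
    ⟨by linarith [hq.2], by linarith [hq.1]⟩
  obtain ⟨m, hm, h1, h2⟩ := exists_integral_eq_qf_gm hq hμ hA hB (Kᴴ *ᵥ v)
  obtain ⟨m', hm', h1', h2'⟩ := exists_integral_eq_qf_gm hq hμ hA' hB' v
  rw [h1, h1']
  refine setIntegral_mono_on hm hm' measurableSet_Ioi fun t (ht : 0 < t) => ?_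
  obtain ⟨y, hy⟩ := (h2' t ht).1
  dsimp only at hy
  rw [← hy]
  refine ((h2 t ht).2 ⟨Kᴴ *ᵥ y, rfl⟩).trans ?_
  dsimp only
  rw [← mulVec_sub, ← qf_mul_mul_conjTranspose, ← qf_mul_mul_conjTranspose]
  gcongr
  exacts [qf_mono hKB _, qf_mono hKA _]

/-- A minimum of a sum is at least the sum of the minima. -/
theorem qf_gm_add_le {q : ℝ} (hq : q ∈ Ioo 0 1) {A B A' B' : Matrix ι ι ℂ}
    (hA : A.PosDef) (hB : B.PosSemidef) (hA' : A'.PosDef) (hB' : B'.PosSemidef) (v : ι → ℂ) :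
    qf (gm q A B) v + qf (gm q A' B') v ≤ qf (gm q (A + A') (B + B')) v := by
  obtain ⟨μ, hμ⟩ := Real.exists_measure_rpow_eq_integral_rpowIntegrand₀₁ (p := 1 - q)
    ⟨by linarith [hq.2], by linarith [hq.1]⟩
  obtain ⟨m, hm, h1, h2⟩ := exists_integral_eq_qf_gm hq hμ hA hB v
  obtain ⟨m', hm', h1', h2'⟩ := exists_integral_eq_qf_gm hq hμ hA' hB' v
  obtain ⟨m'', hm'', h1'', h2''⟩ :=
    exists_integral_eq_qf_gm hq hμ (hA.add hA') (hB.add hB') v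
  rw [h1, h1', h1'', ← integral_add hm hm']
  refine setIntegral_mono_on (hm.add hm') hm'' measurableSet_Ioi fun t (ht : 0 < t) => ?_
  obtain ⟨y, hy⟩ := (h2'' t ht).1
  dsimp only at hy
  rw [← hy, qf_add, qf_add]
  have e1 := (h2 t ht).2 ⟨y, rfl⟩
  have e2 := (h2' t ht).2 ⟨y, rfl⟩
  dsimp only at e1 e2
  linarith

end Variational

/-! ### Real powers of matrices: scaling and continuity. -/

section RealPowers

variable {ι : Type*} [Fintype ι] [DecidableEq ι]

lemma rpow_smul {A : Matrix ι ι ℂ} (hA : A.PosSemidef) {c : ℝ} (hc : 0 ≤ c) (r : ℝ) :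
    ((c : ℂ) • A) ^ r = ((c ^ r : ℝ) : ℂ) • A ^ r := by
  have hcA : 0 ≤ (c : ℂ) • A := (hA.smul (by exact_mod_cast hc : (0 : ℂ) ≤ c)).nonneg
  -- The spectrum is finite, so every function is continuous on it, even a negative power at 0.
  rw [CFC.rpow_eq_cfc_real hcA, CFC.rpow_eq_cfc_real hA.nonneg, Complex.coe_smul,
    Complex.coe_smul, ← cfc_comp_const_mul _ _ _ (((finite_real_spectrum).image _).continuousOn _)
      hA.1.isSelfAdjoint, ← cfc_const_mul _ _ _ (finite_real_spectrum.continuousOn _)]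
  refine cfc_congr fun x hx => ?_
  have hx0 : 0 ≤ x := by
    rw [hA.1.spectrum_real_eq_range_eigenvalues] at hx
    obtain ⟨i, rfl⟩ := hx
    exact hA.eigenvalues_nonneg i
  exact Real.mul_rpow hc hx0

open scoped Matrix.Norms.L2Operator in
lemma exists_le_smul_one {M : Matrix ι ι ℂ} (hM : M.IsHermitian) :
    ∃ c : ℝ, 0 < c ∧ M ≤ (c : ℂ) • (1 : Matrix ι ι ℂ) := by
  refine ⟨‖M‖ + 1, by positivity, ?_⟩
  have h := IsSelfAdjoint.le_algebraMap_norm_self (a := M) hM.isSelfAdjoint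
  refine h.trans ?_
  rw [Algebra.algebraMap_eq_smul_one, ← Complex.coe_smul, le_iff, ← sub_smul]
  refine PosSemidef.smul .one ?_
  push_cast
  simp

open scoped Matrix.Norms.L2Operator in
lemma continuousOn_rpow_of_pos {r : ℝ} (hr : 0 < r) :
    ContinuousOn (fun A : Matrix ι ι ℂ => A ^ r) {A | A.PosSemidef} := by
  lift r to NNReal using hr.le
  have h := CFC.continuousOn_nnrpow (A := Matrix ι ι ℂ) r
  refine (h.mono fun A hA => hA.nonneg).congr fun A hA => ?_
  exact (CFC.nnrpow_eq_rpow (by exact_mod_cast hr)).symm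

end RealPowers

/-! ### The trace functional for an invertible first argument. -/

section InvertibleState

variable {ι κ : Type*} [Fintype ι] [Fintype κ] [DecidableEq ι] [DecidableEq κ] {q : ℝ}

lemma fInv_eq_re_trace_gm (q : ℝ) (A B : Matrix ι ι ℂ) : fInv q A B = (gm q A B).trace.re := rfl

lemma fInv_nonneg (q : ℝ) (A B : Matrix ι ι ℂ) : 0 ≤ fInv q A B :=
  (Complex.le_def.1 (posSemidef_gm q A B).trace_nonneg).1

lemma fInv_smul_smul {A B : Matrix ι ι ℂ} (hA : A.PosSemidef)
    (hB : B.PosSemidef) {a b : ℝ} (ha : 0 < a) (hb : 0 ≤ b) :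
    fInv q ((a : ℂ) • A) ((b : ℂ) • B) = a ^ q * b ^ (1 - q) * fInv q A B := by
  have h1 : ((a ^ (-(1 / 2) : ℝ) : ℝ) : ℂ) • A ^ (-(1 / 2) : ℝ) * (b : ℂ) • B *
      ((a ^ (-(1 / 2) : ℝ) : ℝ) : ℂ) • A ^ (-(1 / 2) : ℝ) =
      ((b / a : ℝ) : ℂ) • (A ^ (-(1 / 2) : ℝ) * B * A ^ (-(1 / 2) : ℝ)) := by
    simp only [smul_mul_assoc, mul_smul_comm, smul_smul, ← Complex.ofReal_mul]
    congr 2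
    rw [mul_left_comm, ← Real.rpow_add ha, ← neg_add, add_halves, Real.rpow_neg_one,
      div_eq_mul_inv]
  rw [fInv, fInv, rpow_smul hA ha.le, rpow_smul hA ha.le, h1,
    rpow_smul (posSemidef_sandwich A hB _) (by positivity)]
  simp only [smul_mul_assoc, mul_smul_comm, smul_smul, ← Complex.ofReal_mul, trace_smul]
  rw [smul_eq_mul, Complex.re_ofReal_mul]
  congr 1
  rw [Real.div_rpow hb ha.le, mul_left_comm, ← Real.rpow_add ha, add_halves, Real.rpow_one,
    Real.rpow_sub ha, Real.rpow_one]
  have := Real.rpow_pos_of_pos ha q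
  field_simp

omit [Fintype ι] in
lemma posDef_add_smul_one {A : Matrix ι ι ℂ} (hA : A.PosSemidef) {ε : ℝ} (hε : 0 < ε) :
    (A + (ε : ℂ) • (1 : Matrix ι ι ℂ)).PosDef :=
  PosDef.posSemidef_add hA (PosDef.one.smul (by exact_mod_cast hε : (0 : ℂ) < ε))

omit [DecidableEq ι] in
lemma re_trace_conj_eq_sum_qf (K : Matrix κ ι ℂ) (M : Matrix ι ι ℂ) :
    (K * M * Kᴴ).trace.re = ∑ i, qf M (Kᴴ *ᵥ Pi.single i 1) := by
  rw [re_trace_eq_sum_qf]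
  exact Finset.sum_congr rfl fun i _ => qf_mul_mul_conjTranspose K M _

lemma re_trace_conj_gm_le (hq : q ∈ Ioo 0 1) {A B : Matrix ι ι ℂ} {A' B' : Matrix κ κ ℂ}
    (hA : A.PosDef) (hB : B.PosSemidef) (hA' : A'.PosDef) (hB' : B'.PosSemidef)
    (K : Matrix κ ι ℂ) (hKA : K * A * Kᴴ ≤ A') (hKB : K * B * Kᴴ ≤ B') :
    (K * gm q A B * Kᴴ).trace.re ≤ fInv q A' B' := by
  rw [re_trace_conj_eq_sum_qf, fInv_eq_re_trace_gm, re_trace_eq_sum_qf]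
  exact Finset.sum_le_sum fun i _ => qf_gm_conj_le hq hA hB hA' hB' K hKA hKB _

lemma fInv_mono_left (hq : q ∈ Ioo 0 1) {A A' B : Matrix ι ι ℂ}
    (hA : A.PosDef) (hA' : A'.PosDef) (hB : B.PosSemidef) (h : A ≤ A') :
    fInv q A B ≤ fInv q A' B := by
  simpa [fInv_eq_re_trace_gm] using
    re_trace_conj_gm_le hq hA hB hA' hB 1 (by simpa using h) (by simp)

lemma fInv_add_le (hq : q ∈ Ioo 0 1) {A B A' B' : Matrix ι ι ℂ}
    (hA : A.PosDef) (hB : B.PosSemidef) (hA' : A'.PosDef) (hB' : B'.PosSemidef) :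
    fInv q A B + fInv q A' B' ≤ fInv q (A + A') (B + B') := by
  simp only [fInv_eq_re_trace_gm, re_trace_eq_sum_qf, ← Finset.sum_add_distrib]
  exact Finset.sum_le_sum fun i _ => qf_gm_add_le hq hA hB hA' hB' _

lemma continuousOn_fInv_right (hq : q ∈ Ioo 0 1) (A : Matrix ι ι ℂ) :
    ContinuousOn (fun B => fInv q A B) {B | B.PosSemidef} := by
  have h1 : ContinuousOn (fun B : Matrix ι ι ℂ =>
      (A ^ (-(1 / 2) : ℝ) * B * A ^ (-(1 / 2) : ℝ)) ^ (1 - q)) {B | B.PosSemidef} :=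
    (continuousOn_rpow_of_pos (sub_pos.2 hq.2)).comp (by fun_prop)
      fun B hB => posSemidef_sandwich A hB _
  have h2 : Continuous fun M : Matrix ι ι ℂ =>
      (Matrix.trace (A ^ (1 / 2 : ℝ) * M * A ^ (1 / 2 : ℝ))).re := by
    unfold Matrix.trace
    fun_prop
  exact h2.comp_continuousOn h1

end InvertibleState

/-! ### Extension to singular states, and data processing. -/

section Limit

variable {ι κ : Type*} [Fintype ι] [Fintype κ] [DecidableEq ι] [DecidableEq κ] {q : ℝ}

lemma monotoneOn_fInv_add_smul_one (hq : q ∈ Ioo 0 1) {A B : Matrix ι ι ℂ} (hA : A.PosSemidef)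
    (hB : B.PosSemidef) :
    MonotoneOn (fun ε : ℝ => fInv q (A + (ε : ℂ) • (1 : Matrix ι ι ℂ)) B) (Ioi 0) := by
  intro ε (hε : 0 < ε) δ (hδ : 0 < δ) h
  refine fInv_mono_left hq (posDef_add_smul_one hA hε) (posDef_add_smul_one hA hδ) hB ?_
  rw [le_iff, add_sub_add_left_eq_sub, ← sub_smul]
  refine PosSemidef.one.smul ?_
  rw [sub_nonneg]
  exact_mod_cast h

lemma bddBelow_image_fInv (q : ℝ) (A B : Matrix ι ι ℂ) (s : Set ℝ) :
    BddBelow ((fun ε : ℝ => fInv q (A + (ε : ℂ) • (1 : Matrix ι ι ℂ)) B) '' s) :=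
  ⟨0, by rintro _ ⟨ε, -, rfl⟩; exact fInv_nonneg _ _ _⟩

/-- The regularised values increase with ε and are nonnegative, so they converge. -/
lemma tendsto_fInv (hq : q ∈ Ioo 0 1) {A B : Matrix ι ι ℂ} (hA : A.PosSemidef)
    (hB : B.PosSemidef) :
    Tendsto (fun ε : ℝ => fInv q (A + (ε : ℂ) • (1 : Matrix ι ι ℂ)) B) (𝓝[>] 0)
      (𝓝 (f q A B)) := by
  have h := (monotoneOn_fInv_add_smul_one hq hA hB).tendsto_nhdsGT (bddBelow_image_fInv q A B _)
  have h2 : f q A B = _ := h.limUnder_eq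
  rwa [h2]

lemma f_nonneg (hq : q ∈ Ioo 0 1) {A B : Matrix ι ι ℂ} (hA : A.PosSemidef)
    (hB : B.PosSemidef) : 0 ≤ f q A B :=
  ge_of_tendsto' (tendsto_fInv hq hA hB) fun _ => fInv_nonneg _ _ _

lemma f_le_fInv (hq : q ∈ Ioo 0 1) {A B : Matrix ι ι ℂ} (hA : A.PosSemidef)
    (hB : B.PosSemidef) {ε : ℝ} (hε : 0 < ε) :
    f q A B ≤ fInv q (A + (ε : ℂ) • (1 : Matrix ι ι ℂ)) B := by
  refine le_of_tendsto (tendsto_fInv hq hA hB) ?_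
  filter_upwards [Ioo_mem_nhdsGT hε] with δ hδ
  exact monotoneOn_fInv_add_smul_one hq hA hB hδ.1 hε hδ.2.le

lemma tendsto_fInv_mul (hq : q ∈ Ioo 0 1) {A B : Matrix ι ι ℂ} (hA : A.PosSemidef)
    (hB : B.PosSemidef) {c : ℝ} (hc : 0 < c) :
    Tendsto (fun ε : ℝ => fInv q (A + ((c * ε : ℝ) : ℂ) • (1 : Matrix ι ι ℂ)) B) (𝓝[>] 0)
      (𝓝 (f q A B)) := by
  refine (tendsto_fInv hq hA hB).comp (f := fun ε : ℝ => c * ε)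
    (tendsto_nhdsWithin_iff.2 ⟨?_, ?_⟩)
  · have : Tendsto (fun ε : ℝ => c * ε) (𝓝 0) (𝓝 (c * 0)) := (continuous_const_mul c).tendsto 0
    rw [mul_zero] at this
    exact this.mono_left nhdsWithin_le_nhds
  · filter_upwards [self_mem_nhdsWithin] with ε (hε : 0 < ε)
    exact mul_pos hc hε

lemma f_eq_fInv (hq : q ∈ Ioo 0 1) {A B : Matrix ι ι ℂ} (hA : A.PosDef)
    (hB : B.PosSemidef) : f q A B = fInv q A B := by
  obtain ⟨c, hc, hle⟩ := exists_le_smul_one hA.inv.1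
  -- Conjugate A⁻¹ ≤ c • 1 by A ^ (1/2).
  have hone : (1 : Matrix ι ι ℂ) ≤ (c : ℂ) • A := by
    have h := (le_iff.1 hle).mul_mul_conjTranspose_same (A ^ (1 / 2 : ℝ))
    have hAinv : A ^ (1 / 2 : ℝ) * A⁻¹ * A ^ (1 / 2 : ℝ) = 1 := by
      have h1 : IsUnit (A ^ (1 / 2 : ℝ)) := hA.isUnit.cfcRpow _ hA.posSemidef.nonneg
      have h2 := (isUnit_iff_isUnit_det _).1 h1
      conv_lhs => enter [1, 2]; rw [← rpow_half_mul_self hA]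
      rw [Matrix.mul_inv_rev, ← mul_assoc, mul_nonsing_inv _ h2, one_mul, nonsing_inv_mul _ h2]
    rw [isHermitian_rpow, mul_sub, sub_mul, hAinv, mul_smul_comm, mul_one, smul_mul_assoc,
      rpow_half_mul_self hA] at h
    exact le_iff.2 h
  refine le_antisymm ?_ ?_
  -- Now A + ε ≤ (1 + cε) A, and homogeneity turns the factor into (1 + cε) ^ q, which tends to 1.
  · have hlim : Tendsto (fun ε : ℝ => (1 + c * ε) ^ q * fInv q A B) (𝓝[>] 0)
        (𝓝 (fInv q A B)) := by
      have : ContinuousAt (fun ε : ℝ => (1 + c * ε) ^ q * fInv q A B) 0 := by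
        refine ContinuousAt.mul (ContinuousAt.rpow_const (by fun_prop) (.inr hq.1.le))
          continuousAt_const
      have h2 := this.tendsto.mono_left (nhdsWithin_le_nhds (s := Ioi 0))
      simpa using h2
    refine le_of_tendsto_of_tendsto (tendsto_fInv hq hA.posSemidef hB) hlim ?_
    filter_upwards [self_mem_nhdsWithin] with ε (hε : 0 < ε)
    have hpos : 0 < 1 + c * ε := by positivity
    have h := fInv_smul_smul (q := q) hA.posSemidef hB hpos zero_le_one
    rw [Real.one_rpow, mul_one, Complex.ofReal_one, one_smul] at h
    rw [← h]
    refine fInv_mono_left hq (posDef_add_smul_one hA.posSemidef hε)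
      (hA.smul (by exact_mod_cast hpos : (0 : ℂ) < _)) hB ?_
    have h3 := (le_iff.1 hone).smul (by exact_mod_cast hε.le : (0 : ℂ) ≤ ε)
    rw [le_iff]
    convert h3 using 1
    push_cast
    module
  · refine ge_of_tendsto (tendsto_fInv hq hA.posSemidef hB) ?_
    filter_upwards [self_mem_nhdsWithin] with ε (hε : 0 < ε)
    refine fInv_mono_left hq hA (posDef_add_smul_one hA.posSemidef hε) hB ?_
    rw [le_iff, add_sub_cancel_left]
    exact PosSemidef.one.smul (by exact_mod_cast hε.le)

lemma f_smul_smul (hq : q ∈ Ioo 0 1) {A B : Matrix ι ι ℂ} (hA : A.PosSemidef)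
    (hB : B.PosSemidef) {a b : ℝ} (ha : 0 ≤ a) (hb : 0 ≤ b) :
    f q ((a : ℂ) • A) ((b : ℂ) • B) = a ^ q * b ^ (1 - q) * f q A B := by
  have hbB : ((b : ℂ) • B).PosSemidef := hB.smul (by exact_mod_cast hb)
  have haA : ((a : ℂ) • A).PosSemidef := hA.smul (by exact_mod_cast ha)
  rcases ha.eq_or_lt with rfl | ha
  · rw [Real.zero_rpow hq.1.ne', zero_mul, zero_mul]
    refine tendsto_nhds_unique (tendsto_fInv hq haA hbB) ?_
    have h : Tendsto (fun ε : ℝ => ε ^ q * 1 * fInv q 1 ((b : ℂ) • B)) (𝓝[>] 0) (𝓝 0) := by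
      have : ContinuousAt (fun ε : ℝ => ε ^ q * 1 * fInv q 1 ((b : ℂ) • B)) 0 := by
        refine ContinuousAt.mul (ContinuousAt.mul
          (ContinuousAt.rpow_const (by fun_prop) (.inr hq.1.le)) continuousAt_const)
          continuousAt_const
      have h2 := this.tendsto.mono_left (nhdsWithin_le_nhds (s := Ioi 0))
      simpa [Real.zero_rpow hq.1.ne'] using h2
    refine h.congr' ?_
    filter_upwards [self_mem_nhdsWithin] with ε (hε : 0 < ε)
    have := fInv_smul_smul (q := q) .one hbB hε zero_le_one
    rw [Real.one_rpow, Complex.ofReal_one, one_smul] at this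
    rw [← this, Complex.ofReal_zero, zero_smul, zero_add]
  -- Regularising a • A by aε keeps a as a common factor: aA + aε = a(A + ε).
  · refine tendsto_nhds_unique (tendsto_fInv_mul hq haA hbB ha) ?_
    refine ((tendsto_fInv hq hA hB).const_mul _).congr' ?_
    filter_upwards [self_mem_nhdsWithin] with ε (hε : 0 < ε)
    rw [← fInv_smul_smul (posDef_add_smul_one hA hε).posSemidef hB ha hb, smul_add, smul_smul,
      Complex.ofReal_mul]

lemma f_zero_zero (hq : q ∈ Ioo 0 1) : f q (0 : Matrix ι ι ℂ) 0 = 0 := by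
  have := f_smul_smul (ι := ι) hq .zero .zero (le_refl 0) (le_refl 0)
  simpa [Real.zero_rpow hq.1.ne'] using this

/-- Since K Kᴴ ≤ c, one has K (A + ε) Kᴴ ≤ K A Kᴴ + cε. The bound is kept at fixed ε so that the
outcomes of a measurement can be summed, using Σ Kᴴ K = 1 under the trace, before the limit. -/
lemma exists_tendsto_re_trace_conj_le (hq : q ∈ Ioo 0 1) {A B : Matrix ι ι ℂ}
    (hA : A.PosSemidef) (hB : B.PosSemidef) (K : Matrix κ ι ℂ) :
    ∃ g : ℝ → ℝ, Tendsto g (𝓝[>] 0) (𝓝 (f q (K * A * Kᴴ) (K * B * Kᴴ))) ∧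
      ∀ ε : ℝ, 0 < ε → (K * gm q (A + (ε : ℂ) • (1 : Matrix ι ι ℂ)) B * Kᴴ).trace.re ≤ g ε := by
  obtain ⟨c, hc, hle⟩ := exists_le_smul_one (posSemidef_self_mul_conjTranspose K).1
  refine ⟨_, tendsto_fInv_mul hq (hA.mul_mul_conjTranspose_same K)
    (hB.mul_mul_conjTranspose_same K) hc, fun ε hε => ?_⟩
  refine re_trace_conj_gm_le hq (posDef_add_smul_one hA hε) hB
    (posDef_add_smul_one (hA.mul_mul_conjTranspose_same K) (mul_pos hc hε))
    (hB.mul_mul_conjTranspose_same K) K ?_ le_rfl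
  have h := (le_iff.1 hle).smul (by exact_mod_cast hε.le : (0 : ℂ) ≤ ε)
  rw [le_iff]
  convert h using 1
  rw [Matrix.mul_add, Matrix.add_mul, Matrix.mul_smul, Matrix.smul_mul, Matrix.mul_one]
  push_cast
  module

/-- Data processing: `f q` increases under a measurement. -/
theorem f_le_sum_conj {N : Type*} [Fintype N] (hq : q ∈ Ioo 0 1) {A B : Matrix ι ι ℂ}
    (hA : A.PosSemidef) (hB : B.PosSemidef) (K : N → Matrix κ ι ℂ) (hK : ∑ n, (K n)ᴴ * K n = 1) :
    f q A B ≤ ∑ n, f q (K n * A * (K n)ᴴ) (K n * B * (K n)ᴴ) := by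
  choose g hg hle using fun n => exists_tendsto_re_trace_conj_le hq hA hB (K n)
  refine le_of_tendsto_of_tendsto (tendsto_fInv hq hA hB) (tendsto_finsetSum _ fun n _ => hg n) ?_
  filter_upwards [self_mem_nhdsWithin] with ε (hε : 0 < ε)
  set M := gm q (A + (ε : ℂ) • (1 : Matrix ι ι ℂ)) B with hM
  have htr : M.trace = ∑ n, (K n * M * (K n)ᴴ).trace := by
    conv_lhs => rw [← one_mul M, ← hK, Finset.sum_mul, trace_sum]
    exact Finset.sum_congr rfl fun n _ => by rw [Matrix.mul_assoc, trace_mul_comm]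
  rw [fInv_eq_re_trace_gm, ← hM, htr, Complex.re_sum]
  exact Finset.sum_le_sum fun n _ => hle n ε hε

/-- Data processing for a measurement with two outcomes in different spaces. -/
theorem f_le_f_conj_add_f_conj {τ : Type*} [Fintype τ] [DecidableEq τ] (hq : q ∈ Ioo 0 1)
    {A B : Matrix ι ι ℂ} (hA : A.PosSemidef) (hB : B.PosSemidef) (K : Matrix κ ι ℂ)
    (L : Matrix τ ι ℂ) (hKL : Kᴴ * K + Lᴴ * L = 1) :
    f q A B ≤ f q (K * A * Kᴴ) (K * B * Kᴴ) + f q (L * A * Lᴴ) (L * B * Lᴴ) := by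
  obtain ⟨g, hg, hle⟩ := exists_tendsto_re_trace_conj_le hq hA hB K
  obtain ⟨g', hg', hle'⟩ := exists_tendsto_re_trace_conj_le hq hA hB L
  refine le_of_tendsto_of_tendsto (tendsto_fInv hq hA hB) (hg.add hg') ?_
  filter_upwards [self_mem_nhdsWithin] with ε (hε : 0 < ε)
  set M := gm q (A + (ε : ℂ) • (1 : Matrix ι ι ℂ)) B with hM
  have htr : M.trace = (K * M * Kᴴ).trace + (L * M * Lᴴ).trace := by
    conv_lhs => rw [← one_mul M, ← hKL, add_mul, trace_add]
    rw [Matrix.mul_assoc Kᴴ, trace_mul_comm Kᴴ, Matrix.mul_assoc Lᴴ, trace_mul_comm Lᴴ]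
  rw [fInv_eq_re_trace_gm, ← hM, htr, Complex.add_re]
  exact add_le_add (hle ε hε) (hle' ε hε)

lemma f_le_f_conj_of_isometry (hq : q ∈ Ioo 0 1) {A B : Matrix ι ι ℂ}
    (hA : A.PosSemidef) (hB : B.PosSemidef) (K : Matrix κ ι ℂ) (hK : Kᴴ * K = 1) :
    f q A B ≤ f q (K * A * Kᴴ) (K * B * Kᴴ) := by
  simpa using f_le_sum_conj hq hA hB (fun _ : Unit => K) (by simpa using hK)

theorem f_add_le (hq : q ∈ Ioo 0 1) {A B A' B' : Matrix ι ι ℂ} (hA : A.PosSemidef)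
    (hB : B.PosSemidef) (hA' : A'.PosSemidef) (hB' : B'.PosSemidef) :
    f q A B + f q A' B' ≤ f q (A + A') (B + B') := by
  refine le_of_tendsto_of_tendsto ((tendsto_fInv hq hA hB).add (tendsto_fInv hq hA' hB'))
    (tendsto_fInv_mul hq (hA.add hA') (hB.add hB') two_pos) ?_
  filter_upwards [self_mem_nhdsWithin] with ε (hε : 0 < ε)
  refine (fInv_add_le hq (posDef_add_smul_one hA hε) hB (posDef_add_smul_one hA' hε) hB').trans
    (le_of_eq ?_)
  congr 1
  push_cast
  module

theorem sum_f_le {N : Type*} (s : Finset N) (hq : q ∈ Ioo 0 1) {A B : N → Matrix ι ι ℂ}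
    (hA : ∀ n, (A n).PosSemidef) (hB : ∀ n, (B n).PosSemidef) :
    ∑ n ∈ s, f q (A n) (B n) ≤ f q (∑ n ∈ s, A n) (∑ n ∈ s, B n) := by
  classical
  induction s using Finset.induction_on with
  | empty => simp [f_zero_zero hq]
  | insert n s hn ih =>
    simp only [Finset.sum_insert hn]
    exact (add_le_add_right ih _).trans (f_add_le hq (hA n) (hB n)
      (posSemidef_sum s fun n _ => hA n) (posSemidef_sum s fun n _ => hB n))

lemma f_smul_one_unit (hq : q ∈ Ioo 0 1) {a b : ℝ} (ha : 0 ≤ a) (hb : 0 ≤ b) :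
    f q ((a : ℂ) • (1 : Matrix Unit Unit ℂ)) ((b : ℂ) • (1 : Matrix Unit Unit ℂ)) =
      a ^ q * b ^ (1 - q) := by
  rw [f_smul_smul hq .one .one ha hb, f_eq_fInv hq .one .one, fInv]
  simp

/-- `f q` is at most its classical value on the outcome distributions of a measurement in an
orthonormal basis. -/
theorem f_le_sum_rpow_mul_rpow (hq : q ∈ Ioo 0 1) {A B : Matrix ι ι ℂ} (hA : A.PosSemidef)
    (hB : B.PosSemidef) {U : Matrix ι ι ℂ} (hU : U * Uᴴ = 1) :
    f q A B ≤ ∑ i, ((Uᴴ * A * U) i i).re ^ q * ((Uᴴ * B * U) i i).re ^ (1 - q) := by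
  -- The Kraus operators are the rows of Uᴴ, mapping to a one-dimensional space, so each outcome is
  -- a scalar.
  have hrow (M : Matrix ι ι ℂ) (hM : M.PosSemidef) (i : ι) :
      (Uᴴ.submatrix (fun _ : Unit => i) id) * M * (Uᴴ.submatrix (fun _ : Unit => i) id)ᴴ =
        ((((Uᴴ * M * U) i i).re : ℝ) : ℂ) • (1 : Matrix Unit Unit ℂ) := by
    have h0 : (Uᴴ.submatrix (fun _ : Unit => i) id) * M *
        (Uᴴ.submatrix (fun _ : Unit => i) id)ᴴ =
        (Uᴴ * M * U).submatrix (fun _ : Unit => i) (fun _ : Unit => i) := by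
      ext
      simp [mul_apply]
    have h1 : 0 ≤ (Uᴴ * M * U) i i := (hM.conjTranspose_mul_mul_same U).diag_nonneg
    ext
    rw [h0]
    simp [← Complex.eq_re_of_ofReal_le (r := 0) (by simpa using h1)]
  have hnn (M : Matrix ι ι ℂ) (hM : M.PosSemidef) (i : ι) : 0 ≤ ((Uᴴ * M * U) i i).re :=
    (Complex.le_def.1 (hM.conjTranspose_mul_mul_same U).diag_nonneg).1
  have h := f_le_sum_conj hq hA hB (fun i : ι => Uᴴ.submatrix (fun _ : Unit => i) id) (by
    rw [← hU]
    ext j k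
    simp [mul_apply, Matrix.sum_apply])
  refine h.trans (le_of_eq (Finset.sum_congr rfl fun i _ => ?_))
  rw [hrow A hA, hrow B hB, f_smul_one_unit hq (hnn A hA i) (hnn B hB i)]

end Limit

/-! ### Hölder's inequality and its equality case. -/

section Scalars

lemma sum_rpow_mul_rpow_le {N : Type*} [Fintype N] {q : ℝ} (hq : q ∈ Ioo 0 1) {x s : N → ℝ}
    (hx : ∀ n, 0 ≤ x n) (hs : ∀ n, 0 ≤ s n) :
    ∑ n, x n ^ q * s n ^ (1 - q) ≤ (∑ n, x n) ^ q * (∑ n, s n) ^ (1 - q) := by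
  have hq' : 1 - q ≠ 0 := (sub_pos.2 hq.2).ne'
  have h := Real.inner_le_Lp_mul_Lq_of_nonneg (s := Finset.univ) (p := 1 / q) (q := 1 / (1 - q))
    (f := fun n => x n ^ q) (g := fun n => s n ^ (1 - q))
    (Real.holderConjugate_iff.2 ⟨by rw [lt_div_iff₀ hq.1]; linarith [hq.2], by simp⟩)
    (fun n _ => Real.rpow_nonneg (hx n) _) (fun n _ => Real.rpow_nonneg (hs n) _)
  have e1 (n : N) : (x n ^ q) ^ (1 / q) = x n := by
    rw [one_div, Real.rpow_rpow_inv (hx n) hq.1.ne']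
  have e2 (n : N) : (s n ^ (1 - q)) ^ (1 / (1 - q)) = s n := by
    rw [one_div, Real.rpow_rpow_inv (hs n) hq']
  simpa only [e1, e2, one_div_one_div] using h

/-- Equality in Hölder: with weights x n / z, z = ∑ x n, the terms add up to z ^ q. -/
lemma rpow_mul_div_rpow {q x z : ℝ} (hx : 0 ≤ x) (hz : 0 < z) :
    x ^ q * (x / z) ^ (1 - q) = x * z ^ (q - 1) := by
  rcases hx.eq_or_lt with rfl | hx
  · by_cases h : q = 0
    · simp [h]
    · simp [Real.zero_rpow h]
  · rw [Real.div_rpow hx.le hz.le, ← mul_div_assoc, ← Real.rpow_add hx, add_sub_cancel,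
      Real.rpow_one, div_eq_mul_inv, ← Real.rpow_neg hz.le, neg_sub]

end Scalars

/-! ### States, incoherent states and measurement outcomes. -/

section States

variable {ι κ : Type*} [Fintype ι] [Fintype κ] [DecidableEq ι] [DecidableEq κ]

omit [DecidableEq ι] in
lemma IsState.nonempty {ρ : Matrix ι ι ℂ} (hρ : IsState ρ) : Nonempty ι := by
  by_contra h
  rw [not_nonempty_iff] at h
  have := hρ.trace_eq_one
  simp [trace] at this

omit [DecidableEq ι] in
lemma trace_eq_ofReal_re {A : Matrix ι ι ℂ} (hA : A.PosSemidef) :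
    A.trace = (A.trace.re : ℂ) :=
  Complex.eq_re_of_ofReal_le (r := 0) (by simpa using hA.trace_nonneg)

omit [DecidableEq ι] in
lemma re_trace_nonneg {A : Matrix ι ι ℂ} (hA : A.PosSemidef) : 0 ≤ A.trace.re :=
  (Complex.le_def.1 hA.trace_nonneg).1

omit [DecidableEq ι] in
lemma eq_zero_of_re_trace_eq_zero {A : Matrix ι ι ℂ} (hA : A.PosSemidef) (h : A.trace.re = 0) :
    A = 0 := by
  rw [← hA.trace_eq_zero_iff, trace_eq_ofReal_re hA, h, Complex.ofReal_zero]

omit [DecidableEq ι] in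
/-- Every positive semidefinite matrix of positive trace is a multiple of a state. -/
lemma isState_inv_re_trace_smul {A : Matrix ι ι ℂ} (hA : A.PosSemidef) (h : 0 < A.trace.re) :
    IsState (((A.trace.re)⁻¹ : ℂ) • A) where
  posSemidef := hA.smul (by rw [← Complex.ofReal_inv]; exact_mod_cast (inv_pos.2 h).le)
  trace_eq_one := by
    have : (A.trace.re : ℂ) ≠ 0 := by exact_mod_cast h.ne'
    rw [trace_smul, smul_eq_mul, trace_eq_ofReal_re hA, Complex.ofReal_re,
      inv_mul_cancel₀ this]

lemma isIncoherent_diagonal {x : ι → ℝ} (hx : x ∈ stdSimplex ℝ ι) :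
    IsIncoherent (diagonal fun i => (x i : ℂ)) where
  isState :=
    { posSemidef := PosSemidef.diagonal fun i => by simpa using hx.1 i
      trace_eq_one := by
        rw [trace_diagonal]
        exact_mod_cast hx.2 }
  isDiag := isDiag_diagonal _

lemma IsIncoherent.exists_eq_diagonal {σ : Matrix ι ι ℂ} (hσ : IsIncoherent σ) :
    ∃ x ∈ stdSimplex ℝ ι, σ = diagonal fun i => (x i : ℂ) := by
  have hd (i : ι) : 0 ≤ σ i i := hσ.isState.posSemidef.diag_nonneg
  refine ⟨fun i => (σ i i).re, ⟨fun i => (Complex.le_def.1 (hd i)).1, ?_⟩, ?_⟩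
  · have := congrArg Complex.re hσ.isState.trace_eq_one
    simpa [trace] using this
  · rw [← hσ.isDiag.diagonal_diag]
    congr 1
    ext i
    simpa using Complex.eq_re_of_ofReal_le (r := 0) (by simpa using hd i)

omit [DecidableEq ι] in
lemma isState_sum_smul {N : Type*} [Fintype N] {p : N → ℝ} {ρ : N → Matrix ι ι ℂ}
    (hp : ∀ n, 0 ≤ p n) (hsum : ∑ n, p n = 1) (hρ : ∀ n, IsState (ρ n)) :
    IsState (∑ n, (p n : ℂ) • ρ n) where
  posSemidef := posSemidef_sum _ fun n _ => (hρ n).posSemidef.smul (by exact_mod_cast hp n)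
  trace_eq_one := by
    simp only [trace_sum, trace_smul, (hρ _).trace_eq_one, smul_eq_mul, mul_one]
    exact_mod_cast hsum

omit [DecidableEq ι] in
lemma isIncoherent_sum_smul {N : Type*} [Fintype N] {p : N → ℝ} {σ : N → Matrix ι ι ℂ}
    (hp : ∀ n, 0 ≤ p n) (hsum : ∑ n, p n = 1) (hσ : ∀ n, IsIncoherent (σ n)) :
    IsIncoherent (∑ n, (p n : ℂ) • σ n) where
  isState := isState_sum_smul hp hsum fun n => (hσ n).isState
  isDiag := by
    intro i j hij
    simp [Matrix.sum_apply, (hσ _).isDiag hij]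

omit [DecidableEq ι] in
lemma prob_nonneg (K : Matrix ι ι ℂ) {ρ : Matrix ι ι ℂ} (hρ : ρ.PosSemidef) : 0 ≤ prob K ρ :=
  re_trace_nonneg (hρ.mul_mul_conjTranspose_same K)

lemma sum_prob {N : ℕ} {K : Fin N → Matrix ι ι ℂ} (hK : ∑ n, (K n)ᴴ * K n = 1)
    {ρ : Matrix ι ι ℂ} (hρ : IsState ρ) : ∑ n, prob (K n) ρ = 1 := by
  have h : ∑ n, (K n * ρ * (K n)ᴴ).trace = 1 := by
    rw [← hρ.trace_eq_one]
    conv_rhs => rw [← one_mul ρ, ← hK, Finset.sum_mul, trace_sum]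
    exact Finset.sum_congr rfl fun n _ => by rw [Matrix.mul_assoc (K n)ᴴ, trace_mul_comm (K n)ᴴ]
  have := congrArg Complex.re h
  simpa [prob] using this

omit [DecidableEq ι] in
lemma prob_smul_post (K : Matrix ι ι ℂ) {ρ : Matrix ι ι ℂ} (hρ : ρ.PosSemidef) :
    ((prob K ρ : ℝ) : ℂ) • post K ρ = K * ρ * Kᴴ := by
  by_cases h : prob K ρ = 0
  · rw [eq_zero_of_re_trace_eq_zero (hρ.mul_mul_conjTranspose_same K) h, h, Complex.ofReal_zero,
      zero_smul]
  · rw [post, smul_smul, mul_inv_cancel₀ (by exact_mod_cast h), one_smul]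

omit [DecidableEq ι] in
lemma isState_post {K : Matrix ι ι ℂ} {ρ : Matrix ι ι ℂ} (hρ : ρ.PosSemidef)
    (h : 0 < prob K ρ) : IsState (post K ρ) :=
  isState_inv_re_trace_smul (hρ.mul_mul_conjTranspose_same K) h

lemma IsIncoherentKraus.isDiag_conj {N : ℕ} {K : Fin N → Matrix ι ι ℂ} (hK : IsIncoherentKraus K)
    (n : Fin N) {σ : Matrix ι ι ℂ} (hσ : IsIncoherent σ) : (K n * σ * (K n)ᴴ).IsDiag := by
  by_cases h : (K n * σ * (K n)ᴴ).trace = 0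
  · rw [((hσ.isState.posSemidef.mul_mul_conjTranspose_same (K n)).trace_eq_zero_iff).1 h]
    exact isDiag_zero
  · have := ((hK.incoherent n σ hσ h).isDiag).smul (K n * σ * (K n)ᴴ).trace
    rwa [smul_smul, mul_inv_cancel₀ h, one_smul] at this

end States

/-! ### The maximal overlap with incoherent states. -/

section Overlap

variable {ι κ : Type*} [Fintype ι] [Fintype κ] [DecidableEq ι] [DecidableEq κ] {q : ℝ}

lemma f_le_one_and_eq_of_f_eq_one (hq : q ∈ Ioo 0 1) {ρ σ : Matrix ι ι ℂ} (hρ : IsState ρ) (hσ : IsState σ) :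
    f q ρ σ ≤ 1 ∧ (f q ρ σ = 1 → ρ = σ) := by
  have hH : (ρ - σ).IsHermitian := hρ.posSemidef.1.sub hσ.posSemidef.1
  set U := (hH.eigenvectorUnitary : Matrix ι ι ℂ) with hU
  have hUU : U * Uᴴ = 1 := Unitary.coe_mul_star_self hH.eigenvectorUnitary
  have hUU' : Uᴴ * U = 1 := Unitary.coe_star_mul_self hH.eigenvectorUnitary
  have htr {M : Matrix ι ι ℂ} (hM : IsState M) : ∑ i, ((Uᴴ * M * U) i i).re = 1 := by
    have h : (Uᴴ * M * U).trace = 1 := by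
      rw [trace_mul_comm, ← mul_assoc, hUU, one_mul, hM.trace_eq_one]
    simpa [trace] using congrArg Complex.re h
  have hnn {M : Matrix ι ι ℂ} (hM : IsState M) (i : ι) : 0 ≤ ((Uᴴ * M * U) i i).re :=
    (Complex.le_def.1 (hM.posSemidef.conjTranspose_mul_mul_same U).diag_nonneg).1
  have hle := f_le_sum_rpow_mul_rpow hq hρ.posSemidef hσ.posSemidef hUU
  have hterm (i : ι) := Real.geom_mean_le_arith_mean2_weighted hq.1.le (sub_pos.2 hq.2).le
    (hnn hρ i) (hnn hσ i) (add_sub_cancel q 1)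
  have hsum : ∑ i, (q * ((Uᴴ * ρ * U) i i).re + (1 - q) * ((Uᴴ * σ * U) i i).re) = 1 := by
    rw [Finset.sum_add_distrib, ← Finset.mul_sum, ← Finset.mul_sum, htr hρ, htr hσ]
    ring
  refine ⟨hle.trans ((Finset.sum_le_sum fun i _ => hterm i).trans hsum.le), fun h1 => ?_⟩
  have heq := (Finset.sum_eq_sum_iff_of_le fun i (_ : i ∈ Finset.univ) => hterm i).1
    (le_antisymm (Finset.sum_le_sum fun i _ => hterm i) (hsum.le.trans (h1.symm.le.trans hle)))
  -- Equality in AM-GM makes both outcome distributions equal, and their differences are the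
  -- eigenvalues of ρ - σ.
  have hdiag (i : ι) : hH.eigenvalues i = 0 := by
    have h2 := ((Real.geom_mean_eq_arith_mean2_weighted_iff_of_pos hq.1 (sub_pos.2 hq.2)
      (hnn hρ i) (hnn hσ i) (add_sub_cancel q 1)).1 (heq i (Finset.mem_univ i)))
    have h3 : Uᴴ * (ρ - σ) * U = diagonal fun i => (hH.eigenvalues i : ℂ) := by
      have := hH.spectral_theorem
      rw [Unitary.conjStarAlgAut_apply, ← hU, star_eq_conjTranspose] at this
      conv_lhs => rw [this]
      rw [mul_assoc, mul_assoc, hUU', mul_one, ← mul_assoc, hUU', one_mul]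
      rfl
    have h4 := congrArg Complex.re (congrFun (congrFun h3 i) i)
    rw [mul_sub, sub_mul, Matrix.sub_apply, Complex.sub_re, h2, sub_self, diagonal_apply_eq,
      Complex.ofReal_re] at h4
    exact h4.symm
  have := hH.eigenvalues_eq_zero_iff.1 (funext hdiag)
  exact sub_eq_zero.1 this

/-- As ρ may be singular, it is split into multiples of basis projections. Each projection is an
isometric image of the one-dimensional state, where `f` is 1, and superadditivity collects the
pieces. -/
lemma one_le_f_self_of_isIncoherent (hq : q ∈ Ioo 0 1) {ρ : Matrix ι ι ℂ} (hρ : IsIncoherent ρ) :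
    1 ≤ f q ρ ρ := by
  obtain ⟨x, hx, rfl⟩ := hρ.exists_eq_diagonal
  have hE (i : ι) : (Matrix.single i i (1 : ℂ)).PosSemidef := by
    rw [← diagonal_single]
    exact PosSemidef.diagonal (Pi.single_nonneg.2 zero_le_one)
  have h1 (i : ι) : 1 ≤ f q (Matrix.single i i (1 : ℂ)) (Matrix.single i i 1) := by
    have h := f_le_f_conj_of_isometry hq (A := (1 : Matrix Unit Unit ℂ)) (B := 1) .one .one
      (Matrix.of fun (j : ι) (_ : Unit) => (Pi.single i 1 : ι → ℂ) j) (by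
        ext
        simp [mul_apply, Pi.single_apply])
    have h2 := f_smul_one_unit hq zero_le_one zero_le_one
    simp only [Complex.ofReal_one, one_smul, Real.one_rpow, mul_one] at h2
    rw [h2] at h
    convert h using 2 <;>
    · ext j k
      simp [mul_apply, Pi.single_apply, Matrix.single_apply, ite_and, eq_comm]
      split_ifs <;> rfl
  have hsum : (diagonal fun i => (x i : ℂ)) = ∑ i, (x i : ℂ) • Matrix.single i i (1 : ℂ) := by
    simp [← sum_single_eq_diagonal, smul_single]
  rw [hsum]
  refine le_trans ?_ (sum_f_le Finset.univ hq (A := fun i => (x i : ℂ) • Matrix.single i i (1 : ℂ))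
    (B := fun i => (x i : ℂ) • Matrix.single i i (1 : ℂ))
    (fun i => (hE i).smul (by exact_mod_cast hx.1 i))
    (fun i => (hE i).smul (by exact_mod_cast hx.1 i)))
  rw [← hx.2]
  refine Finset.sum_le_sum fun i _ => ?_
  rw [f_smul_smul hq (hE i) (hE i) (hx.1 i) (hx.1 i)]
  have h2 : x i ^ q * x i ^ (1 - q) = x i := by
    rw [← Real.rpow_add' (hx.1 i) (by simp), add_sub_cancel, Real.rpow_one]
  rw [h2]
  exact le_mul_of_one_le_right (hx.1 i) (h1 i)

/-- As an infimum over ε of functions continuous in σ, `f q ρ` is upper semicontinuous, hence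
attains its maximum on the compact simplex of diagonal states. -/
lemma exists_isIncoherent_forall_f_le (hq : q ∈ Ioo 0 1) {ρ : Matrix ι ι ℂ} (hρ : IsState ρ) :
    ∃ σ, IsIncoherent σ ∧ ∀ τ, IsIncoherent τ → f q ρ τ ≤ f q ρ σ := by
  have := hρ.nonempty
  obtain ⟨i⟩ := this
  have husc : UpperSemicontinuousOn (fun x : ι → ℝ => f q ρ (diagonal fun i => (x i : ℂ)))
      (stdSimplex ℝ ι) := by
    intro x hx y hy
    have hpsd {x : ι → ℝ} (hx : x ∈ stdSimplex ℝ ι) :=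
      (isIncoherent_diagonal hx).isState.posSemidef
    obtain ⟨ε, hlt, hε⟩ := (((tendsto_fInv hq hρ.posSemidef (hpsd hx)).eventually_lt_const
      hy).and self_mem_nhdsWithin).exists
    have hcont : ContinuousOn (fun x : ι → ℝ =>
        fInv q (ρ + (ε : ℂ) • (1 : Matrix ι ι ℂ)) (diagonal fun i => (x i : ℂ)))
        (stdSimplex ℝ ι) := by
      refine (continuousOn_fInv_right hq _).comp (Continuous.continuousOn ?_) fun x hx => hpsd hx
      exact Continuous.matrix_diagonal (by fun_prop)
    filter_upwards [(hcont x hx).eventually_lt_const hlt, self_mem_nhdsWithin] with z hz hzs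
    exact (f_le_fInv hq hρ.posSemidef (hpsd hzs) hε).trans_lt hz
  obtain ⟨x, hx, hmax⟩ := husc.exists_isMaxOn ⟨_, single_mem_stdSimplex ℝ i⟩
    (isCompact_stdSimplex ℝ ι)
  refine ⟨_, isIncoherent_diagonal hx, fun τ hτ => ?_⟩
  obtain ⟨y, hy, rfl⟩ := hτ.exists_eq_diagonal
  exact hmax hy

theorem isLeast_C (hq : q ∈ Ioo 0 1) {ρ : Matrix ι ι ℂ} (hρ : IsState ρ) :
    IsLeast ((fun σ => D q ρ σ) '' {σ : Matrix ι ι ℂ | IsIncoherent σ}) (C q ρ) := by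
  obtain ⟨σ, hσ, hmax⟩ := exists_isIncoherent_forall_f_le hq hρ
  have h : IsLeast ((fun σ => D q ρ σ) '' {σ : Matrix ι ι ℂ | IsIncoherent σ}) (D q ρ σ) := by
    refine ⟨⟨σ, hσ, rfl⟩, ?_⟩
    rintro _ ⟨τ, hτ, rfl⟩
    -- The prefactor is negative, so maximising `f` minimises `D`.
    have h0 : 1 / (q - 1) ≤ 0 := one_div_nonpos.2 (by linarith [hq.2])
    refine mul_le_mul_of_nonpos_left (sub_le_sub_right ?_ _) h0
    exact Real.rpow_le_rpow (f_nonneg hq hρ.posSemidef hτ.isState.posSemidef) (hmax τ hτ)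
      (one_div_nonneg.2 hq.1.le)
  have h2 : C q ρ = D q ρ σ := h.csInf_eq
  rwa [h2]

/-- The largest value of `f q ρ σ ^ (1 / q)` on incoherent states `σ`. -/
noncomputable def overlap (q : ℝ) (ρ : Matrix ι ι ℂ) : ℝ := 1 - (1 - q) * C q ρ

lemma C_eq_overlap (hq : q ∈ Ioo 0 1) (ρ : Matrix ι ι ℂ) :
    C q ρ = (1 - overlap q ρ) / (1 - q) := by
  have : 1 - q ≠ 0 := (sub_pos.2 hq.2).ne'
  rw [overlap]
  field_simp
  ring

lemma one_sub_mul_D (hq : q ∈ Ioo 0 1) (ρ σ : Matrix ι ι ℂ) :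
    1 - (1 - q) * D q ρ σ = f q ρ σ ^ (1 / q) := by
  have : q - 1 ≠ 0 := (sub_neg.2 hq.2).ne
  rw [D]
  field_simp
  ring

lemma exists_overlap_eq (hq : q ∈ Ioo 0 1) {ρ : Matrix ι ι ℂ} (hρ : IsState ρ) :
    ∃ σ, IsIncoherent σ ∧ overlap q ρ = f q ρ σ ^ (1 / q) := by
  obtain ⟨σ, hσ, h⟩ := (isLeast_C hq hρ).1
  exact ⟨σ, hσ, by rw [overlap, ← h, one_sub_mul_D hq]⟩

lemma f_rpow_le_overlap (hq : q ∈ Ioo 0 1) {ρ σ : Matrix ι ι ℂ} (hρ : IsState ρ)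
    (hσ : IsIncoherent σ) : f q ρ σ ^ (1 / q) ≤ overlap q ρ := by
  have h := (isLeast_C hq hρ).2 ⟨σ, hσ, rfl⟩
  dsimp only at h
  rw [overlap, ← one_sub_mul_D hq]
  have : 0 ≤ 1 - q := (sub_pos.2 hq.2).le
  gcongr

lemma overlap_nonneg (hq : q ∈ Ioo 0 1) {ρ : Matrix ι ι ℂ} (hρ : IsState ρ) :
    0 ≤ overlap q ρ := by
  obtain ⟨σ, hσ, h⟩ := exists_overlap_eq hq hρ
  rw [h]
  exact Real.rpow_nonneg (f_nonneg hq hρ.posSemidef hσ.isState.posSemidef) _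

lemma f_le_overlap_rpow (hq : q ∈ Ioo 0 1) {ρ σ : Matrix ι ι ℂ} (hρ : IsState ρ)
    (hσ : IsIncoherent σ) : f q ρ σ ≤ overlap q ρ ^ q := by
  have h0 := f_nonneg hq hρ.posSemidef hσ.isState.posSemidef
  have h := Real.rpow_le_rpow (Real.rpow_nonneg h0 _) (f_rpow_le_overlap hq hρ hσ) hq.1.le
  rwa [one_div, Real.rpow_inv_rpow h0 hq.1.ne'] at h

lemma exists_overlap_rpow_eq (hq : q ∈ Ioo 0 1) {ρ : Matrix ι ι ℂ} (hρ : IsState ρ) :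
    ∃ σ, IsIncoherent σ ∧ f q ρ σ = overlap q ρ ^ q := by
  obtain ⟨σ, hσ, h⟩ := exists_overlap_eq hq hρ
  refine ⟨σ, hσ, ?_⟩
  rw [h, one_div, Real.rpow_inv_rpow (f_nonneg hq hρ.posSemidef hσ.isState.posSemidef) hq.1.ne']

lemma le_overlap_of_rpow_le_f (hq : q ∈ Ioo 0 1) {ρ σ : Matrix ι ι ℂ} (hρ : IsState ρ)
    (hσ : IsIncoherent σ) {z : ℝ} (hz : 0 ≤ z) (h : z ^ q ≤ f q ρ σ) : z ≤ overlap q ρ := by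
  refine le_trans ?_ (f_rpow_le_overlap hq hρ hσ)
  have := Real.rpow_le_rpow (Real.rpow_nonneg hz _) h (one_div_nonneg.2 hq.1.le)
  rwa [one_div, Real.rpow_rpow_inv hz hq.1.ne', ← one_div] at this

/-- The bound on `f q` for unnormalised arguments. -/
lemma f_smul_le (hq : q ∈ Ioo 0 1) {ρ B : Matrix ι ι ℂ} (hρ : IsState ρ) (hB : B.PosSemidef)
    (hBd : B.IsDiag) {p : ℝ} (hp : 0 ≤ p) :
    f q ((p : ℂ) • ρ) B ≤ (p * overlap q ρ) ^ q * B.trace.re ^ (1 - q) := by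
  rcases (re_trace_nonneg hB).eq_or_lt with h | h
  · rw [eq_zero_of_re_trace_eq_zero hB h.symm]
    have h2 := f_smul_smul hq hρ.posSemidef (.zero (n := ι)) hp (le_refl 0)
    rw [Real.zero_rpow (sub_pos.2 hq.2).ne', smul_zero, mul_zero, zero_mul] at h2
    rw [h2]
    simp [Real.zero_rpow (sub_pos.2 hq.2).ne']
  · have hσ : IsIncoherent (((B.trace.re)⁻¹ : ℂ) • B) :=
      ⟨isState_inv_re_trace_smul hB h, hBd.smul _⟩
    have h1 : B = (B.trace.re : ℂ) • (((B.trace.re)⁻¹ : ℂ) • B) := by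
      rw [smul_smul, mul_inv_cancel₀ (by exact_mod_cast h.ne'), one_smul]
    conv_lhs => rw [h1]
    rw [f_smul_smul hq hρ.posSemidef hσ.isState.posSemidef hp h.le,
      Real.mul_rpow hp (overlap_nonneg hq hρ), mul_right_comm]
    have := f_le_overlap_rpow hq hρ hσ
    gcongr

end Overlap

/-! ### Faithfulness, strong monotonicity, convexity, monotonicity. -/

section CoherenceMeasure

variable {ι κ : Type*} [Fintype ι] [Fintype κ] [DecidableEq ι] [DecidableEq κ] {q : ℝ}

lemma overlap_le_one (hq : q ∈ Ioo 0 1) {ρ : Matrix ι ι ℂ} (hρ : IsState ρ) :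
    overlap q ρ ≤ 1 := by
  obtain ⟨σ, hσ, h⟩ := exists_overlap_eq hq hρ
  rw [h]
  exact Real.rpow_le_one (f_nonneg hq hρ.posSemidef hσ.isState.posSemidef)
    (f_le_one_and_eq_of_f_eq_one hq hρ hσ.isState).1 (one_div_nonneg.2 hq.1.le)

lemma overlap_eq_one_iff (hq : q ∈ Ioo 0 1) {ρ : Matrix ι ι ℂ} (hρ : IsState ρ) :
    overlap q ρ = 1 ↔ IsIncoherent ρ := by
  constructor
  · intro h1
    obtain ⟨σ, hσ, h⟩ := exists_overlap_rpow_eq hq hρ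
    rw [h1, Real.one_rpow] at h
    rwa [(f_le_one_and_eq_of_f_eq_one hq hρ hσ.isState).2 h]
  · intro h
    refine le_antisymm (overlap_le_one hq hρ) (le_overlap_of_rpow_le_f hq hρ h zero_le_one ?_)
    rw [Real.one_rpow]
    exact one_le_f_self_of_isIncoherent hq h

lemma C_nonneg (hq : q ∈ Ioo 0 1) {ρ : Matrix ι ι ℂ} (hρ : IsState ρ) : 0 ≤ C q ρ := by
  rw [C_eq_overlap hq]
  exact div_nonneg (sub_nonneg.2 (overlap_le_one hq hρ)) (sub_pos.2 hq.2).le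

lemma C_eq_zero_iff (hq : q ∈ Ioo 0 1) {ρ : Matrix ι ι ℂ} (hρ : IsState ρ) :
    C q ρ = 0 ↔ IsIncoherent ρ := by
  rw [C_eq_overlap hq, div_eq_zero_iff, or_iff_left (sub_pos.2 hq.2).ne', sub_eq_zero, eq_comm,
    overlap_eq_one_iff hq hρ]

lemma sum_mul_C {N : Type*} [Fintype N] (hq : q ∈ Ioo 0 1) {p : N → ℝ} (hp : ∑ n, p n = 1)
    (ρ : N → Matrix ι ι ℂ) :
    ∑ n, p n * C q (ρ n) = (1 - ∑ n, p n * overlap q (ρ n)) / (1 - q) := by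
  simp only [C_eq_overlap hq, mul_div_assoc', ← Finset.sum_div, mul_sub, mul_one,
    Finset.sum_sub_distrib, hp]

/-- With σ optimal for ρ and s_n its outcome probabilities, G(ρ) ^ q ≤ Σ (p_n G(ρ_n)) ^ q s_n ^
(1-q) ≤ (Σ p_n G(ρ_n)) ^ q. -/
theorem sum_prob_mul_C_post_le (hq : q ∈ Ioo 0 1) {N : ℕ} {K : Fin N → Matrix ι ι ℂ}
    (hK : IsIncoherentKraus K) {ρ : Matrix ι ι ℂ} (hρ : IsState ρ) :
    ∑ n, prob (K n) ρ * C q (post (K n) ρ) ≤ C q ρ := by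
  rw [sum_mul_C hq (sum_prob hK.complete hρ), C_eq_overlap hq]
  refine div_le_div_of_nonneg_right (sub_le_sub_left ?_ 1) (sub_pos.2 hq.2).le
  obtain ⟨σ, hσ, h⟩ := exists_overlap_rpow_eq hq hρ
  -- An outcome of probability zero has the zero matrix as `post`, not a state; only its zero weight
  -- helps.
  have hx (n : Fin N) : 0 ≤ prob (K n) ρ * overlap q (post (K n) ρ) := by
    rcases (prob_nonneg (K n) hρ.posSemidef).eq_or_lt with h0 | h0
    · rw [← h0, zero_mul]
    · exact mul_nonneg h0.le (overlap_nonneg hq (isState_post hρ.posSemidef h0))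
  rw [← Real.rpow_le_rpow_iff (overlap_nonneg hq hρ) (Finset.sum_nonneg fun n _ => hx n) hq.1, ← h]
  refine (f_le_sum_conj hq hρ.posSemidef hσ.isState.posSemidef K hK.complete).trans ?_
  have hB (n : Fin N) := hσ.isState.posSemidef.mul_mul_conjTranspose_same (K n)
  have hn (n : Fin N) : f q (K n * ρ * (K n)ᴴ) (K n * σ * (K n)ᴴ) ≤
      (prob (K n) ρ * overlap q (post (K n) ρ)) ^ q * prob (K n) σ ^ (1 - q) := by
    rw [← prob_smul_post (K n) hρ.posSemidef]
    rcases (prob_nonneg (K n) hρ.posSemidef).eq_or_lt with h0 | h0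
    · have h2 := f_smul_smul hq hρ.posSemidef (hB n) (le_refl 0) zero_le_one
      rw [Complex.ofReal_one, one_smul, Real.zero_rpow hq.1.ne', Complex.ofReal_zero, zero_smul,
        zero_mul, zero_mul] at h2
      rw [← h0, Complex.ofReal_zero, zero_smul, h2, zero_mul, Real.zero_rpow hq.1.ne', zero_mul]
    · exact f_smul_le hq (isState_post hρ.posSemidef h0) (hB n) (hK.isDiag_conj n hσ) h0.le
  refine (Finset.sum_le_sum fun n _ => hn n).trans ?_
  refine (sum_rpow_mul_rpow_le hq hx fun n => prob_nonneg (K n) hσ.isState.posSemidef).trans ?_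
  rw [sum_prob hK.complete hσ.isState, Real.one_rpow, mul_one]

/-- The competitor is the mixture of the optimal σ_n with weights proportional to p_n G(ρ_n), rather
than p_n. -/
theorem C_sum_smul_le {N : Type*} [Fintype N] (hq : q ∈ Ioo 0 1) {p : N → ℝ}
    {ρ : N → Matrix ι ι ℂ} (hp : ∀ n, 0 ≤ p n) (hsum : ∑ n, p n = 1) (hρ : ∀ n, IsState (ρ n)) :
    C q (∑ n, (p n : ℂ) • ρ n) ≤ ∑ n, p n * C q (ρ n) := by
  have hstate := isState_sum_smul hp hsum hρ
  rw [sum_mul_C hq hsum, C_eq_overlap hq]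
  refine div_le_div_of_nonneg_right (sub_le_sub_left ?_ 1) (sub_pos.2 hq.2).le
  choose σ hσ h using fun n => exists_overlap_rpow_eq hq (hρ n)
  have hx (n : N) : 0 ≤ p n * overlap q (ρ n) := mul_nonneg (hp n) (overlap_nonneg hq (hρ n))
  set z := ∑ n, p n * overlap q (ρ n) with hz
  have hz0 : 0 ≤ z := Finset.sum_nonneg fun n _ => hx n
  -- If z = 0 the weights cannot be normalised, but then nonnegativity of the overlap suffices.
  rcases hz0.eq_or_lt with h0 | h0
  · rw [← h0]
    exact overlap_nonneg hq hstate
  have hs (n : N) : 0 ≤ p n * overlap q (ρ n) / z := div_nonneg (hx n) h0.le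
  have hs1 : ∑ n, p n * overlap q (ρ n) / z = 1 := by
    rw [← Finset.sum_div, ← hz, div_self h0.ne']
  refine le_overlap_of_rpow_le_f hq hstate (isIncoherent_sum_smul hs hs1 hσ) h0.le ?_
  refine le_trans (le_of_eq ?_) (sum_f_le Finset.univ hq
    (fun n => (hρ n).posSemidef.smul (by exact_mod_cast hp n))
    (fun n => (hσ n).isState.posSemidef.smul (by exact_mod_cast hs n)))
  have hn (n : N) : f q ((p n : ℂ) • ρ n) (((p n * overlap q (ρ n) / z : ℝ) : ℂ) • σ n) =
      p n * overlap q (ρ n) * z ^ (q - 1) := by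
    rw [f_smul_smul hq (hρ n).posSemidef (hσ n).isState.posSemidef (hp n) (hs n), h n,
      mul_right_comm, ← Real.mul_rpow (hp n) (overlap_nonneg hq (hρ n)),
      rpow_mul_div_rpow (hx n) h0]
  rw [Finset.sum_congr rfl fun n _ => hn n, ← Finset.sum_mul, ← hz,
    Real.rpow_sub h0, Real.rpow_one]
  field_simp

theorem C_sum_conj_le (hq : q ∈ Ioo 0 1) {N : ℕ} {K : Fin N → Matrix ι ι ℂ}
    (hK : IsIncoherentKraus K) {ρ : Matrix ι ι ℂ} (hρ : IsState ρ) :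
    C q (∑ n, K n * ρ * (K n)ᴴ) ≤ C q ρ := by
  classical
  set τ : Fin N → Matrix ι ι ℂ := fun n => if 0 < prob (K n) ρ then post (K n) ρ else ρ with hτ
  have hstate (n : Fin N) : IsState (τ n) := by
    by_cases h : 0 < prob (K n) ρ
    · simpa [hτ, h] using isState_post hρ.posSemidef h
    · simpa [hτ, h] using hρ
  have hzero {n : Fin N} (h : ¬0 < prob (K n) ρ) : prob (K n) ρ = 0 :=
    le_antisymm (not_lt.1 h) (prob_nonneg (K n) hρ.posSemidef)
  have h1 : ∑ n, K n * ρ * (K n)ᴴ = ∑ n, ((prob (K n) ρ : ℝ) : ℂ) • τ n := by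
    refine Finset.sum_congr rfl fun n _ => ?_
    rw [← prob_smul_post (K n) hρ.posSemidef]
    by_cases h : 0 < prob (K n) ρ
    · simp [hτ, h]
    · simp [hzero h]
  rw [h1]
  refine (C_sum_smul_le hq (fun n => prob_nonneg (K n) hρ.posSemidef)
    (sum_prob hK.complete hρ) hstate).trans (le_trans (le_of_eq ?_)
      (sum_prob_mul_C_post_le hq hK hρ))
  refine Finset.sum_congr rfl fun n _ => ?_
  by_cases h : 0 < prob (K n) ρ
  · simp [hτ, h]
  · simp [hzero h]

/-- Serves to embed a block into the direct sum, a change of space that `IsIncoherentKraus` does not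
allow. -/
lemma C_conj_le_of_isometry (hq : q ∈ Ioo 0 1) {ρ : Matrix ι ι ℂ} (hρ : IsState ρ)
    (K : Matrix κ ι ℂ) (hK : Kᴴ * K = 1)
    (hinc : ∀ σ : Matrix ι ι ℂ, σ.IsDiag → (K * σ * Kᴴ).IsDiag) : C q (K * ρ * Kᴴ) ≤ C q ρ := by
  have hstate {σ : Matrix ι ι ℂ} (hσ : IsState σ) : IsState (K * σ * Kᴴ) :=
    ⟨hσ.posSemidef.mul_mul_conjTranspose_same K, by
      rw [trace_mul_comm, ← Matrix.mul_assoc, hK, one_mul, hσ.trace_eq_one]⟩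
  rw [C_eq_overlap hq, C_eq_overlap hq ρ]
  refine div_le_div_of_nonneg_right (sub_le_sub_left ?_ 1) (sub_pos.2 hq.2).le
  obtain ⟨σ, hσ, h⟩ := exists_overlap_rpow_eq hq hρ
  refine le_overlap_of_rpow_le_f hq (hstate hρ) ⟨hstate hσ.isState, hinc σ hσ.isDiag⟩
    (overlap_nonneg hq hρ) ?_
  rw [← h]
  exact f_le_f_conj_of_isometry hq hρ.posSemidef hσ.isState.posSemidef K hK

end CoherenceMeasure

/-! ### Additivity on block-diagonal states. -/

section BlockDiagonal

variable {ι κ : Type*} [Fintype ι] [Fintype κ] [DecidableEq ι] [DecidableEq κ] {q : ℝ}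

variable (ι κ) in
/-- The inclusion of the first summand. -/
def inlMatrix : Matrix (ι ⊕ κ) ι ℂ := fromRows 1 0

variable (ι κ) in
/-- The inclusion of the second summand. -/
def inrMatrix : Matrix (ι ⊕ κ) κ ℂ := fromRows 0 1

omit [Fintype κ] [DecidableEq κ] in
lemma inlMatrix_conj (M : Matrix ι ι ℂ) :
    inlMatrix ι κ * M * (inlMatrix ι κ)ᴴ = fromBlocks M 0 0 0 := by
  simp [inlMatrix, conjTranspose_fromRows_eq_fromCols_conjTranspose, fromRows_mul,
    ← fromCols_fromRows_eq_fromBlocks]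

omit [Fintype ι] [DecidableEq ι] in
lemma inrMatrix_conj (M : Matrix κ κ ℂ) :
    inrMatrix ι κ * M * (inrMatrix ι κ)ᴴ = fromBlocks 0 0 0 M := by
  simp [inrMatrix, conjTranspose_fromRows_eq_fromCols_conjTranspose, fromRows_mul,
    ← fromCols_fromRows_eq_fromBlocks]

omit [DecidableEq κ] in
lemma conjTranspose_inlMatrix_mul_self : (inlMatrix ι κ)ᴴ * inlMatrix ι κ = 1 := by
  simp [inlMatrix, conjTranspose_fromRows_eq_fromCols_conjTranspose, fromCols_mul_fromRows]

omit [DecidableEq ι] in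
lemma conjTranspose_inrMatrix_mul_self : (inrMatrix ι κ)ᴴ * inrMatrix ι κ = 1 := by
  simp [inrMatrix, conjTranspose_fromRows_eq_fromCols_conjTranspose, fromCols_mul_fromRows]

lemma inlMatrix_mul_add_inrMatrix_mul :
    inlMatrix ι κ * (inlMatrix ι κ)ᴴ + inrMatrix ι κ * (inrMatrix ι κ)ᴴ = 1 := by
  have h1 := inlMatrix_conj (κ := κ) (1 : Matrix ι ι ℂ)
  have h2 := inrMatrix_conj (ι := ι) (1 : Matrix κ κ ℂ)
  rw [Matrix.mul_one] at h1 h2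
  rw [h1, h2, fromBlocks_add]
  simp

omit [DecidableEq κ] in
lemma conjTranspose_inlMatrix_conj (a : Matrix ι ι ℂ) (b : Matrix ι κ ℂ) (c : Matrix κ ι ℂ)
    (d : Matrix κ κ ℂ) : (inlMatrix ι κ)ᴴ * fromBlocks a b c d * inlMatrix ι κ = a := by
  simp [inlMatrix, conjTranspose_fromRows_eq_fromCols_conjTranspose, fromCols_mul_fromBlocks,
    fromCols_mul_fromRows]

omit [DecidableEq ι] in
lemma conjTranspose_inrMatrix_conj (a : Matrix ι ι ℂ) (b : Matrix ι κ ℂ) (c : Matrix κ ι ℂ)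
    (d : Matrix κ κ ℂ) : (inrMatrix ι κ)ᴴ * fromBlocks a b c d * inrMatrix ι κ = d := by
  simp [inrMatrix, conjTranspose_fromRows_eq_fromCols_conjTranspose, fromCols_mul_fromBlocks,
    fromCols_mul_fromRows]

-- Casts the block sum as a two-term mixture, the form in which convexity applies.
omit [Fintype ι] [Fintype κ] [DecidableEq ι] [DecidableEq κ] in
lemma fromBlocks_smul_eq (p r : ℝ) (ρ₁ : Matrix ι ι ℂ) (ρ₂ : Matrix κ κ ℂ) :
    fromBlocks ((p : ℂ) • ρ₁) 0 0 ((r : ℂ) • ρ₂) =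
      ∑ b : Bool, ((cond b p r : ℝ) : ℂ) • cond b (fromBlocks ρ₁ 0 0 0) (fromBlocks 0 0 0 ρ₂) := by
  simp [fromBlocks_smul, fromBlocks_add]

omit [DecidableEq ι] [DecidableEq κ] in
lemma trace_fromBlocks_eq (a : Matrix ι ι ℂ) (b : Matrix ι κ ℂ) (c : Matrix κ ι ℂ)
    (d : Matrix κ κ ℂ) : (fromBlocks a b c d).trace = a.trace + d.trace := by
  simp [trace]

omit [DecidableEq κ] in
lemma IsState.fromBlocks_left {ρ : Matrix ι ι ℂ} (hρ : IsState ρ) :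
    IsState (fromBlocks ρ 0 0 (0 : Matrix κ κ ℂ)) where
  posSemidef := inlMatrix_conj (κ := κ) ρ ▸ hρ.posSemidef.mul_mul_conjTranspose_same _
  trace_eq_one := by simp [trace_fromBlocks_eq, hρ.trace_eq_one]

omit [DecidableEq ι] in
lemma IsState.fromBlocks_right {ρ : Matrix κ κ ℂ} (hρ : IsState ρ) :
    IsState (fromBlocks (0 : Matrix ι ι ℂ) 0 0 ρ) where
  posSemidef := inrMatrix_conj (ι := ι) ρ ▸ hρ.posSemidef.mul_mul_conjTranspose_same _
  trace_eq_one := by simp [trace_fromBlocks_eq, hρ.trace_eq_one]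

lemma C_fromBlocks_left_le (hq : q ∈ Ioo 0 1) {ρ : Matrix ι ι ℂ} (hρ : IsState ρ) :
    C q (fromBlocks ρ 0 0 (0 : Matrix κ κ ℂ)) ≤ C q ρ := by
  rw [← inlMatrix_conj]
  refine C_conj_le_of_isometry hq hρ _ conjTranspose_inlMatrix_mul_self fun σ hσ => ?_
  rw [inlMatrix_conj]
  exact hσ.fromBlocks (isDiag_zero)

lemma C_fromBlocks_right_le (hq : q ∈ Ioo 0 1) {ρ : Matrix κ κ ℂ} (hρ : IsState ρ) :
    C q (fromBlocks (0 : Matrix ι ι ℂ) 0 0 ρ) ≤ C q ρ := by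
  rw [← inrMatrix_conj]
  refine C_conj_le_of_isometry hq hρ _ conjTranspose_inrMatrix_mul_self fun σ hσ => ?_
  rw [inrMatrix_conj]
  exact isDiag_zero.fromBlocks hσ

theorem C_fromBlocks (hq : q ∈ Ioo 0 1) {p : ℝ} (hp0 : 0 ≤ p) (hp1 : p ≤ 1) {ρ₁ : Matrix ι ι ℂ}
    {ρ₂ : Matrix κ κ ℂ} (hρ₁ : IsState ρ₁) (hρ₂ : IsState ρ₂) :
    C q (fromBlocks ((p : ℂ) • ρ₁) 0 0 (((1 - p : ℝ) : ℂ) • ρ₂)) =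
      p * C q ρ₁ + (1 - p) * C q ρ₂ := by
  have hp1' : 0 ≤ 1 - p := sub_nonneg.2 hp1
  have hp (b : Bool) : 0 ≤ cond b p (1 - p) := by cases b <;> assumption
  have hsum : ∑ b : Bool, cond b p (1 - p) = 1 := by simp
  have hτ (b : Bool) :
      IsState (cond b (fromBlocks ρ₁ 0 0 0) (fromBlocks 0 0 0 ρ₂) : Matrix (ι ⊕ κ) (ι ⊕ κ) ℂ) := by
    cases b
    exacts [hρ₂.fromBlocks_right, hρ₁.fromBlocks_left]
  refine le_antisymm ?_ ?_
  · rw [fromBlocks_smul_eq]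
    refine (C_sum_smul_le hq hp hsum hτ).trans ?_
    simp only [Fintype.sum_bool, cond_true, cond_false]
    gcongr
    exacts [C_fromBlocks_left_le hq hρ₁, C_fromBlocks_right_le hq hρ₂]
  · have hstate : IsState (fromBlocks ((p : ℂ) • ρ₁) 0 0 (((1 - p : ℝ) : ℂ) • ρ₂)) := by
      rw [fromBlocks_smul_eq]
      exact isState_sum_smul hp hsum hτ
    have hG : overlap q (fromBlocks ((p : ℂ) • ρ₁) 0 0 (((1 - p : ℝ) : ℂ) • ρ₂)) ≤
        p * overlap q ρ₁ + (1 - p) * overlap q ρ₂ := by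
      obtain ⟨σ, hσ, h⟩ := exists_overlap_rpow_eq hq hstate
      obtain ⟨a, b, c, d, rfl⟩ : ∃ a b c d, σ = fromBlocks a b c d :=
        ⟨_, _, _, _, (fromBlocks_toBlocks σ).symm⟩
      have hpsd := hσ.isState.posSemidef
      have ha : a.PosSemidef := hpsd.submatrix Sum.inl
      have hd : d.PosSemidef := hpsd.submatrix Sum.inr
      obtain ⟨had, -, -, hdd⟩ := isDiag_fromBlocks_iff.1 hσ.isDiag
      have htr : a.trace.re + d.trace.re = 1 := by
        have := congrArg Complex.re hσ.isState.trace_eq_one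
        simpa [trace_fromBlocks_eq] using this
      have hx₁ := mul_nonneg hp0 (overlap_nonneg hq hρ₁)
      have hx₂ := mul_nonneg hp1' (overlap_nonneg hq hρ₂)
      rw [← Real.rpow_le_rpow_iff (overlap_nonneg hq hstate) (add_nonneg hx₁ hx₂) hq.1, ← h]
      -- Measuring the block leaves p ρ₁ against a and (1 - p) ρ₂ against d; Hölder with Tr a + Tr d
      -- = 1 concludes.
      refine (f_le_f_conj_add_f_conj hq hstate.posSemidef hpsd (inlMatrix ι κ)ᴴ (inrMatrix ι κ)ᴴ
        (by simpa only [conjTranspose_conjTranspose] using inlMatrix_mul_add_inrMatrix_mul)).trans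
        ?_
      simp only [conjTranspose_conjTranspose, conjTranspose_inlMatrix_conj,
        conjTranspose_inrMatrix_conj]
      refine (add_le_add (f_smul_le hq hρ₁ ha had hp0) (f_smul_le hq hρ₂ hd hdd hp1')).trans ?_
      have := sum_rpow_mul_rpow_le hq
        (x := fun b => cond b (p * overlap q ρ₁) ((1 - p) * overlap q ρ₂))
        (s := fun b => cond b a.trace.re d.trace.re)
        (by rintro (_ | _) <;> assumption)
        (by rintro (_ | _); exacts [re_trace_nonneg hd, re_trace_nonneg ha])
      simpa [htr] using this
    rw [C_eq_overlap hq, C_eq_overlap hq, C_eq_overlap hq, mul_div_assoc', mul_div_assoc',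
      ← add_div]
    exact div_le_div_of_nonneg_right (by linarith) (sub_pos.2 hq.2).le

end BlockDiagonal

theorem isCoherenceMeasure_C {q : ℝ} (hq : q ∈ Ioo 0 1) :
    IsCoherenceMeasure.{u} (fun (ι : Type u) [Fintype ι] [DecidableEq ι] (ρ : Matrix ι ι ℂ) =>
      C q ρ) where
  nonneg _ _ _ _ hρ := C_nonneg hq hρ
  eq_zero_iff _ _ _ _ hρ := C_eq_zero_iff hq hρ
  monotone := by
    rintro ι _ _ Φ ρ ⟨N, K, hK, hΦ⟩ hρ
    rw [hΦ]
    exact C_sum_conj_le hq hK hρ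
  strong_monotone _ _ _ _ _ _ hK hρ := sum_prob_mul_C_post_le hq hK hρ
  convex _ _ _ _ _ _ hp hsum hρ := C_sum_smul_le hq hp hsum hρ
  additive _ _ _ _ _ _ _ _ _ hp0 hp1 hρ₁ hρ₂ := C_fromBlocks hq hp0 hp1 hρ₁ hρ₂

end TsallisCoherence

theorem mainTheorem1 (q : ℝ) (hq0 : 0 < q) (hq1 : q < 1) :
    (∀ (ι : Type u) [Fintype ι] [DecidableEq ι] (ρ σ : Matrix ι ι ℂ),
      TsallisCoherence.IsState ρ → TsallisCoherence.IsState σ →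
        Filter.Tendsto
          (fun ε : ℝ => TsallisCoherence.fInv q (ρ + (ε : ℂ) • (1 : Matrix ι ι ℂ)) σ)
          (nhdsWithin (0 : ℝ) (Set.Ioi 0)) (nhds (TsallisCoherence.f q ρ σ)) ∧
        (ρ.PosDef → TsallisCoherence.f q ρ σ = TsallisCoherence.fInv q ρ σ)) ∧
    (∀ (ι : Type u) [Fintype ι] [DecidableEq ι] (ρ : Matrix ι ι ℂ),
      TsallisCoherence.IsState ρ →
        IsLeast
          ((fun σ => TsallisCoherence.D q ρ σ) ''
            {σ : Matrix ι ι ℂ | TsallisCoherence.IsIncoherent σ})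
          (TsallisCoherence.C q ρ)) ∧
    TsallisCoherence.IsCoherenceMeasure.{u}
      (fun (ι : Type u) [Fintype ι] [DecidableEq ι] (ρ : Matrix ι ι ℂ) =>
        TsallisCoherence.C q ρ) :=
  ⟨fun _ _ _ _ _ hρ hσ =>
    ⟨TsallisCoherence.tendsto_fInv ⟨hq0, hq1⟩ hρ.posSemidef hσ.posSemidef,
      fun h => TsallisCoherence.f_eq_fInv ⟨hq0, hq1⟩ h hσ.posSemidef⟩,
    fun _ _ _ _ hρ => TsallisCoherence.isLeast_C ⟨hq0, hq1⟩ hρ,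
    TsallisCoherence.isCoherenceMeasure_C ⟨hq0, hq1⟩⟩
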